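/- Let $d\ge 1$ and $s\ge 2$, and let $\Omega\subset\mathbb{R}^d$ be thick, that is, $\Omega$ is Lebesgue measurable and there is $R>0$ such that $\inf_{a\in\mathbb{R}^d}\bigl|\Omega\cap(a+[-R,R]^d)\bigr|>0$. For $\sigma\in\mathbb{R}$ let $(-\Delta+1)^{\sigma/2}$ be the Fourier multiplier with symbol $(|\xi|^2+1)^{\sigma/2}$, where $-\Delta$ has symbol $|\xi|^2$, let $H^\sigma(\mathbb{R}^d)$ be the space of complex-valued tempered distributions $u$ with $(-\Delta+1)^{\sigma/2}u\in L^2(\mathbb{R}^d)$, and put $\|u\|_{H^\sigma}=\|(-\Delta+1)^{\sigma/2}u\|_{L^2}$. Let $\mathcal{A}_0$ be the undamped fractional wave generator $$\mathcal{A}_0\begin{pmatrix}u_1\\u_2\end{pmatrix}=\begin{pmatrix}u_2\\-(-\Delta+1)^{s/2}u_1\end{pmatrix},$$ an unbounded operator on $H^{s/2}(\mathbb{R}^d)\times L^2(\mathbb{R}^d)$ with domain $H^s(\mathbb{R}^d)\times H^{s/2}(\mathbb{R}^d)$, where $\|(u_1,u_2)\|^2_{H^{s/2}\times L^2}=\|u_1\|^2_{H^{s/2}}+\|u_2\|^2_{L^2}$.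 Then there exist constants $C,c>0$ such that for all $U=(u_1,u_2)\in H^s(\mathbb{R}^d)\times H^{s/2}(\mathbb{R}^d)$ and all $\lambda\in\mathbb{R}$, $$c\,e^{-C|\lambda|}\,\|U\|^2_{H^{s/2}\times L^2}\le\|(\mathcal{A}_0-i\lambda I)U\|^2_{H^{s/2}\times L^2}+\|u_2\|^2_{L^2(\Omega)}.$$ -/

import Mathlib

open MeasureTheory TemperedDistribution
open scoped SchwartzMap ENNReal Real

noncomputable section

namespace FractionalWave

/-- The space `ℝ^d` with its Euclidean norm. -/
abbrev Rd (d : ℕ) := EuclideanSpace ℝ (Fin d)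

/-- The complex Hilbert space `L²(ℝ^d)`. -/
abbrev L2 (d : ℕ) := Lp ℂ 2 (volume : Measure (Rd d))

/-- A set is thick if it is measurable and, for some `R > 0`, the measure of its intersection with
the cubes of side length `2R` is bounded from below, uniformly in the centre of the cube. -/
def IsThick {d : ℕ} (Ω : Set (Rd d)) : Prop :=
  MeasurableSet Ω ∧ ∃ R : ℝ, 0 < R ∧ 0 < ⨅ a : Rd d, volume (Ω ∩ {x | ∀ i, |x i - a i| ≤ R})

/-! ### The operators `(1 - Δ)^{σ/2}` -/

/-- The symbol of `(1 - Δ)^{σ/2}`. The Fourier transform of Mathlib has the kernel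
`exp (-2πi x·ξ)`, so that `-Δ` has the symbol `‖2πξ‖²`. -/
def fracSymbol (d : ℕ) (σ : ℝ) (ξ : Rd d) : ℝ := (1 + ‖(2 * π) • ξ‖ ^ 2) ^ (σ / 2)

/-- The operator `(1 - Δ)^{σ/2}` on tempered distributions. -/
def fracOp (d : ℕ) (σ : ℝ) : 𝓢'(Rd d, ℂ) →L[ℂ] 𝓢'(Rd d, ℂ) :=
  fourierMultiplierCLM ℂ (fun ξ ↦ (fracSymbol d σ ξ : ℂ))

theorem hasTemperateGrowth_fracSymbol (d : ℕ) (σ : ℝ) :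
    (fracSymbol d σ).HasTemperateGrowth :=
  (Function.hasTemperateGrowth_one_add_norm_sq_rpow (Rd d) (σ / 2)).comp
    (((2 * π) • ContinuousLinearMap.id ℝ (Rd d)).hasTemperateGrowth)

theorem hasTemperateGrowth_fracSymbol_ofReal (d : ℕ) (σ : ℝ) :
    (fun ξ ↦ (fracSymbol d σ ξ : ℂ)).HasTemperateGrowth := by
  have := hasTemperateGrowth_fracSymbol d σ
  fun_prop

theorem fracOp_zero (d : ℕ) : fracOp d 0 = ContinuousLinearMap.id ℂ _ := by
  ext f
  simp [fracOp, fracSymbol]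

theorem fracOp_fracOp (d : ℕ) (σ τ : ℝ) (u : 𝓢'(Rd d, ℂ)) :
    fracOp d τ (fracOp d σ u) = fracOp d (σ + τ) u := by
  simp only [fracOp]
  rw [fourierMultiplierCLM_fourierMultiplierCLM_apply (hasTemperateGrowth_fracSymbol_ofReal d σ)
    (hasTemperateGrowth_fracSymbol_ofReal d τ)]
  congr 2
  ext ξ
  simp only [Pi.mul_apply, fracSymbol]
  norm_cast
  rw [← Real.rpow_add (by positivity)]
  ring_nf

theorem rpow_le_of_le {t B r : ℝ} (h1 : 1 ≤ t) (hB : t ≤ B) : t ^ r ≤ B ^ |r| :=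
  (Real.rpow_le_rpow_of_exponent_le h1 (le_abs_self r)).trans
    (Real.rpow_le_rpow (by linarith) hB (abs_nonneg r))

theorem ratio_bound (d : ℕ) (r : ℝ) (ξ : Rd d) :
    (1 + ‖(2 * π) • ξ‖ ^ 2) ^ r * (1 + ‖ξ‖ ^ 2) ^ (-r) ≤ ((2 * π) ^ 2) ^ |r| := by
  have hp : (0 : ℝ) < 1 + ‖ξ‖ ^ 2 := by positivity
  have hpi : (1 : ℝ) ≤ (2 * π) ^ 2 := by nlinarith [Real.pi_gt_three]
  have hn : ‖(2 * π) • ξ‖ ^ 2 = (2 * π) ^ 2 * ‖ξ‖ ^ 2 := by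
    rw [norm_smul, mul_pow, Real.norm_eq_abs, sq_abs]
  rw [Real.rpow_neg hp.le, ← div_eq_mul_inv, ← Real.div_rpow (by positivity) hp.le, hn]
  have hx := sq_nonneg ‖ξ‖
  refine rpow_le_of_le ?_ ?_
  · rw [le_div_iff₀ hp]; nlinarith
  · rw [div_le_iff₀ hp]; nlinarith

/-- The Sobolev space `H^σ` of Mathlib is the domain of `(1 - Δ)^{σ/2}` in `L²`. -/
theorem memSobolev_iff_fracOp {d : ℕ} {σ : ℝ} {u : 𝓢'(Rd d, ℂ)} :
    MemSobolev σ 2 u ↔ ∃ f : L2 d, fracOp d σ u = f := by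
  have hB : ∀ r : ℝ, (fun ξ : Rd d ↦ (((1 + ‖ξ‖ ^ 2) ^ r : ℝ) : ℂ)).HasTemperateGrowth := by
    intro r
    fun_prop
  have hM : ∀ τ r : ℝ, (fun ξ : Rd d ↦
      (fracSymbol d τ ξ : ℂ) * (((1 + ‖ξ‖ ^ 2) ^ r : ℝ) : ℂ)).HasTemperateGrowth :=
    fun τ r ↦ (hasTemperateGrowth_fracSymbol_ofReal d τ).mul (hB r)
  constructor
  · intro h
    rw [← add_zero σ, ← memSobolev_besselPotential_iff] at h
    have key : fracOp d σ u = fourierMultiplierCLM ℂ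
        (fun ξ ↦ (fracSymbol d σ ξ : ℂ) * (((1 + ‖ξ‖ ^ 2) ^ (-(σ / 2)) : ℝ) : ℂ))
        (besselPotential (Rd d) ℂ σ u) := by
      rw [besselPotential, fourierMultiplierCLM_fourierMultiplierCLM_apply (hB _) (hM _ _), fracOp]
      congr 2
      ext ξ
      simp only [Pi.mul_apply]
      norm_cast
      rw [mul_left_comm, ← Real.rpow_add (by positivity)]
      simp
    rw [key]
    refine memSobolev_zero_iff.1 (h.fourierMultiplierCLM_of_bounded
      (hM _ _) ⟨((2 * π) ^ 2) ^ |σ / 2|, ?_⟩)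
    intro ξ
    rw [← Complex.ofReal_mul, Complex.norm_real, Real.norm_eq_abs, fracSymbol,
      abs_of_nonneg (by positivity)]
    exact ratio_bound d (σ / 2) ξ
  · intro h
    rw [← memSobolev_zero_iff] at h
    rw [← add_zero σ, ← memSobolev_besselPotential_iff]
    have key : besselPotential (Rd d) ℂ σ u = fourierMultiplierCLM ℂ
        (fun ξ ↦ (fracSymbol d (-σ) ξ : ℂ) * (((1 + ‖ξ‖ ^ 2) ^ (σ / 2) : ℝ) : ℂ))
        (fracOp d σ u) := by
      rw [fracOp, fourierMultiplierCLM_fourierMultiplierCLM_apply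
        (hasTemperateGrowth_fracSymbol_ofReal d σ)
        (hM _ _), besselPotential]
      congr 2
      ext ξ
      simp only [Pi.mul_apply, fracSymbol]
      norm_cast
      rw [← mul_assoc, ← Real.rpow_add (by positivity), neg_div, add_neg_cancel, Real.rpow_zero,
        one_mul]
    rw [key]
    refine h.fourierMultiplierCLM_of_bounded
      (hM _ _) ⟨((2 * π) ^ 2) ^ |-(σ / 2)|, ?_⟩
    intro ξ
    rw [← Complex.ofReal_mul, Complex.norm_real, Real.norm_eq_abs, fracSymbol,
      abs_of_nonneg (by positivity)]
    rw [neg_div]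
    have := ratio_bound d (-(σ / 2)) ξ
    rwa [neg_neg] at this

/-! ### Sobolev spaces -/

/-- The Sobolev space `H^σ(ℝ^d)` of Mathlib, as a linear subspace of the tempered distributions. -/
def sobolevSubmodule (d : ℕ) (σ : ℝ) : Submodule ℂ 𝓢'(Rd d, ℂ) where
  carrier := {u | MemSobolev σ 2 u}
  add_mem' := MemSobolev.add
  zero_mem' := memSobolev_fun_zero _ _ _ _
  smul_mem' c _ h := h.smul c

/-- The Sobolev space `H^σ(ℝ^d)` as a type (a type of its own, because its topology is not the one
that it inherits from the tempered distributions). -/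
def Sobolev (d : ℕ) (σ : ℝ) : Type := sobolevSubmodule d σ

instance (d : ℕ) (σ : ℝ) : AddCommGroup (Sobolev d σ) :=
  inferInstanceAs (AddCommGroup (sobolevSubmodule d σ))

instance (d : ℕ) (σ : ℝ) : Module ℂ (Sobolev d σ) :=
  inferInstanceAs (Module ℂ (sobolevSubmodule d σ))

/-- The inclusion of `H^σ(ℝ^d)` into the tempered distributions. -/
def Sobolev.toDist {d : ℕ} {σ : ℝ} : Sobolev d σ →ₗ[ℂ] 𝓢'(Rd d, ℂ) :=
  (sobolevSubmodule d σ).subtype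

theorem Sobolev.toDist_injective {d : ℕ} {σ : ℝ} :
    Function.Injective (Sobolev.toDist : Sobolev d σ → 𝓢'(Rd d, ℂ)) :=
  Subtype.val_injective

theorem Sobolev.memSobolev {d : ℕ} {σ : ℝ} (u : Sobolev d σ) : MemSobolev σ 2 u.toDist := u.2

/-- A tempered distribution in `H^σ(ℝ^d)`, as an element of this space. -/
def Sobolev.mk {d : ℕ} {σ : ℝ} (u : 𝓢'(Rd d, ℂ)) (hu : MemSobolev σ 2 u) : Sobolev d σ := ⟨u, hu⟩

theorem Sobolev.toDist_mk {d : ℕ} {σ : ℝ} (u : 𝓢'(Rd d, ℂ)) (hu : MemSobolev σ 2 u) :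
    (Sobolev.mk u hu).toDist = u := rfl

/-- The inclusion of `L²(ℝ^d)` into the tempered distributions. -/
def L2.toDist {d : ℕ} : L2 d →ₗ[ℂ] 𝓢'(Rd d, ℂ) :=
  (Lp.toTemperedDistributionCLM ℂ (volume : Measure (Rd d)) 2).toLinearMap

theorem L2.toDist_apply {d : ℕ} (f : L2 d) : L2.toDist f = (f : 𝓢'(Rd d, ℂ)) := rfl

theorem L2.toDist_injective {d : ℕ} : Function.Injective (L2.toDist : L2 d → 𝓢'(Rd d, ℂ)) :=
  LinearMap.ker_eq_bot.1 Lp.ker_toTemperedDistributionCLM_eq_bot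

/-- The function `(1 - Δ)^{σ/2} u ∈ L²(ℝ^d)` for `u ∈ H^σ(ℝ^d)`. -/
def Sobolev.fracFun {d : ℕ} {σ : ℝ} (u : Sobolev d σ) : L2 d :=
  (memSobolev_iff_fracOp.1 u.memSobolev).choose

theorem Sobolev.toDist_fracFun {d : ℕ} {σ : ℝ} (u : Sobolev d σ) :
    L2.toDist u.fracFun = fracOp d σ u.toDist :=
  (memSobolev_iff_fracOp.1 u.memSobolev).choose_spec.symm

/-- The operator `(1 - Δ)^{σ/2}` as a linear map from `H^σ(ℝ^d)` to `L²(ℝ^d)`. -/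
def Sobolev.frac {d : ℕ} {σ : ℝ} : Sobolev d σ →ₗ[ℂ] L2 d where
  toFun := Sobolev.fracFun
  map_add' u v := L2.toDist_injective <| by
    rw [map_add]
    simp only [Sobolev.toDist_fracFun, map_add]
  map_smul' c u := L2.toDist_injective <| by
    rw [RingHom.id_apply, map_smul]
    simp only [Sobolev.toDist_fracFun, map_smul]

theorem Sobolev.toDist_frac {d : ℕ} {σ : ℝ} (u : Sobolev d σ) :
    L2.toDist u.frac = fracOp d σ u.toDist := u.toDist_fracFun

theorem Sobolev.frac_injective {d : ℕ} {σ : ℝ} :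
    Function.Injective (Sobolev.frac : Sobolev d σ → L2 d) := by
  intro u v h
  apply Sobolev.toDist_injective
  have h' : fracOp d σ u.toDist = fracOp d σ v.toDist := by
    rw [← u.toDist_frac, ← v.toDist_frac, h]
  simpa [fracOp_fracOp, fracOp_zero] using congrArg (fracOp d (-σ)) h'

/-- The norm `‖u‖_{H^σ} = ‖(1 - Δ)^{σ/2} u‖_{L²}`. -/
instance (d : ℕ) (σ : ℝ) : NormedAddCommGroup (Sobolev d σ) :=
  NormedAddCommGroup.induced _ _ Sobolev.frac Sobolev.frac_injective

instance (d : ℕ) (σ : ℝ) : NormedSpace ℂ (Sobolev d σ) :=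
  NormedSpace.induced ℂ _ _ Sobolev.frac

theorem Sobolev.norm_def {d : ℕ} {σ : ℝ} (u : Sobolev d σ) : ‖u‖ = ‖u.frac‖ := rfl

/-! ### The undamped fractional wave generator -/

/-- The energy space `H^{s/2}(ℝ^d) × L²(ℝ^d)`, with `‖(u₁, u₂)‖² = ‖u₁‖² + ‖u₂‖²`. -/
abbrev Energy (d : ℕ) (s : ℝ) := WithLp 2 (Sobolev d (s / 2) × L2 d)

theorem Energy.norm_sq {d : ℕ} {s : ℝ} (U : Energy d s) :
    ‖U‖ ^ 2 = ‖U.fst‖ ^ 2 + ‖U.snd‖ ^ 2 :=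
  WithLp.prod_norm_sq_eq_of_L2 U

/-- The subspace `H^s(ℝ^d) × H^{s/2}(ℝ^d)` of the energy space. -/
def waveDomain (d : ℕ) (s : ℝ) : Submodule ℂ (Energy d s) where
  carrier := {U | MemSobolev s 2 (Sobolev.toDist U.fst) ∧ MemSobolev (s / 2) 2 (L2.toDist U.snd)}
  add_mem' {U V} hU hV := by
    refine ⟨?_, ?_⟩
    · rw [WithLp.add_fst, map_add]
      exact hU.1.add hV.1
    · rw [WithLp.add_snd, map_add]
      exact hU.2.add hV.2
  zero_mem' := by
    refine ⟨?_, ?_⟩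
    · rw [WithLp.zero_fst, map_zero]
      exact memSobolev_fun_zero (Rd d) ℂ s 2
    · rw [WithLp.zero_snd, map_zero]
      exact memSobolev_fun_zero (Rd d) ℂ (s / 2) 2
  smul_mem' c U hU := by
    refine ⟨?_, ?_⟩
    · rw [WithLp.smul_fst, map_smul]
      exact hU.1.smul c
    · rw [WithLp.smul_snd, map_smul]
      exact hU.2.smul c

/-- The first component of an element of the domain, as an element of `H^s(ℝ^d)`. -/
def waveDomain.fst {d : ℕ} {s : ℝ} (U : waveDomain d s) : Sobolev d s :=
  Sobolev.mk (Sobolev.toDist U.val.fst) U.property.1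

/-- The second component of an element of the domain, as an element of `H^{s/2}(ℝ^d)`. -/
def waveDomain.snd {d : ℕ} {s : ℝ} (U : waveDomain d s) : Sobolev d (s / 2) :=
  Sobolev.mk (L2.toDist U.val.snd) U.property.2

theorem waveDomain.toDist_fst {d : ℕ} {s : ℝ} (U : waveDomain d s) :
    Sobolev.toDist (waveDomain.fst U) = Sobolev.toDist U.val.fst := Sobolev.toDist_mk _ _

theorem waveDomain.toDist_snd {d : ℕ} {s : ℝ} (U : waveDomain d s) :
    Sobolev.toDist (waveDomain.snd U) = L2.toDist U.val.snd := Sobolev.toDist_mk _ _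

theorem waveDomain.fst_add {d : ℕ} {s : ℝ} (U V : waveDomain d s) :
    waveDomain.fst (U + V) = waveDomain.fst U + waveDomain.fst V :=
  Sobolev.toDist_injective <| by
    rw [map_add, toDist_fst, toDist_fst, toDist_fst, ← map_add, ← WithLp.add_fst]
    rfl

theorem waveDomain.snd_add {d : ℕ} {s : ℝ} (U V : waveDomain d s) :
    waveDomain.snd (U + V) = waveDomain.snd U + waveDomain.snd V :=
  Sobolev.toDist_injective <| by
    rw [map_add, toDist_snd, toDist_snd, toDist_snd, ← map_add, ← WithLp.add_snd]
    rfl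

theorem waveDomain.fst_smul {d : ℕ} {s : ℝ} (c : ℂ) (U : waveDomain d s) :
    waveDomain.fst (c • U) = c • waveDomain.fst U :=
  Sobolev.toDist_injective <| by
    rw [map_smul, toDist_fst, toDist_fst, ← map_smul, ← WithLp.smul_fst]
    rfl

theorem waveDomain.snd_smul {d : ℕ} {s : ℝ} (c : ℂ) (U : waveDomain d s) :
    waveDomain.snd (c • U) = c • waveDomain.snd U :=
  Sobolev.toDist_injective <| by
    rw [map_smul, toDist_snd, toDist_snd, ← map_smul, ← WithLp.smul_snd]
    rfl

/-- The undamped fractional wave generator `A₀ (u₁, u₂) = (u₂, -(1 - Δ)^{s/2} u₁)`, an unbounded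
operator on `H^{s/2}(ℝ^d) × L²(ℝ^d)` with domain `H^s(ℝ^d) × H^{s/2}(ℝ^d)`. -/
def waveGenerator (d : ℕ) (s : ℝ) : Energy d s →ₗ.[ℂ] Energy d s where
  domain := waveDomain d s
  toFun :=
    { toFun := fun U ↦ WithLp.toLp 2 (waveDomain.snd U, -Sobolev.frac (waveDomain.fst U))
      map_add' := fun U V ↦ by
        rw [waveDomain.fst_add, waveDomain.snd_add, map_add, neg_add, ← WithLp.toLp_add,
          Prod.mk_add_mk]
      map_smul' := fun c U ↦ by
        rw [waveDomain.fst_smul, waveDomain.snd_smul, map_smul, RingHom.id_apply, ← smul_neg,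
          ← WithLp.toLp_smul, Prod.smul_mk] }
theorem waveGenerator_apply {d : ℕ} {s : ℝ} (U : (waveGenerator d s).domain) :
    waveGenerator d s U =
      WithLp.toLp 2 (waveDomain.snd U, -Sobolev.frac (waveDomain.fst U)) := rfl

end FractionalWave

end

/-!
On the Fourier side the resolvent equation `(A₀ - iλ)(u₁, u₂) = (f₁, f₂)` is a `2 × 2` system with
the frequency `m = (1 + |ξ|²)^{s/4}`, and it gives `(m² - λ²) û₂ = m² f̂₁ - iλ f̂₂`. Where
`m ≥ |λ| + 1`, this bounds `û₂` by the data (`norm_velocity_le`). Since `s ≥ 2`, one has `m ≥ |ξ|`,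
so the remaining part of `u₂` is band-limited to `|ξ| ≤ |λ| + 1`, and the Logvinenko–Sereda theorem
(`logvinenko_sereda`) recovers it from the thick set `Ω` with a constant exponential in `|λ|`. The
component `u₁` is then read off from `m² û₁ = -f̂₂ - iλ û₂`, as `m ≥ 1`.

The Logvinenko–Sereda theorem is proved by polynomial approximation along segments. For every `x`,
the set `E` of pairs `(h, τ)`, with `h` in a fixed cube and `τ ∈ [0, 1]`, such that `x + τ h ∈ Ω`
has a measure bounded from below (`le_measure_segments`). A polynomial `p` in `τ` of degree at most
`n` with `p 0 ≠ 0` satisfies `p τ = p 0 * ∏ (1 - w i * τ)`, so that Hölder's inequality bounds the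
integral of `|p 0 / p τ|^{1/(2n)}` over `[0, 1]` by an absolute constant
(`lintegral_poly_inv_rpow_le`). Hence `|p 0|²` is at most of the order of `Kⁿ` times the integral of
`|p|²` over `E`, also for a family of polynomials with the same value at `0`
(`remez_of_common_value`). This applies to the Taylor polynomials of `τ ↦ f (x + τ h)` for `f` with
a Fourier transform supported in `|ξ| ≤ N` (with the normalization of Mathlib, in `2π ‖ξ‖ ≤ N`).
Integration over `x` turns the main term into the norm of `f` in `L²(Ω)`. By Plancherel's theorem
the remainder is at most `L⁻ⁿ exp (L N ρ)` times the norm of `f`, for any base `L ≥ 1`, where `ρ`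
bounds the lengths of the `h` (`lintegral_enorm_sq_taylorRem_le`). For `L` large in terms of `K`,
and `n` a large multiple of `N + 1`, the remainder is absorbed, and the constant that is left is
exponential in `N`.
-/

namespace FractionalWave

open FourierTransform

/-! ### A Remez inequality for polynomials -/

open Polynomial in
/-- A polynomial function of degree at most `n` with constant term `1` is a product of `n` factors
`1 - w τ`. The `w i` are the roots of the reversed polynomial. -/
theorem exists_prod_one_sub_eq (n : ℕ) (a : ℕ → ℂ) (ha : a 0 = 1) :
    ∃ w : Fin n → ℂ, ∀ τ : ℂ, ∑ k ∈ Finset.range (n + 1), a k * τ ^ k = ∏ i, (1 - w i * τ) := by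
  set q : ℂ[X] := ∑ k ∈ Finset.range (n + 1), C (a k) * X ^ (n - k) with hq
  have hq' : q = X ^ n + ∑ k ∈ Finset.range n, C (a (k + 1)) * X ^ (n - (k + 1)) := by
    rw [hq, Finset.sum_range_succ']
    simp [ha, add_comm]
  have hdeg :
      (∑ k ∈ Finset.range n, C (a (k + 1)) * X ^ (n - (k + 1))).degree < (n : WithBot ℕ) := by
    refine mem_degreeLT.1 (Submodule.sum_mem _ fun k hk ↦ mem_degreeLT.2 ?_)
    refine (degree_C_mul_X_pow_le _ _).trans_lt ?_
    have := Finset.mem_range.1 hk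
    exact_mod_cast (by lia : n - (k + 1) < n)
  have hmonic : q.Monic := by
    rw [hq']
    exact monic_X_pow_add hdeg
  have hnat : q.natDegree = n := by
    rw [hq']
    exact natDegree_eq_of_degree_eq_some <| by
      rw [degree_add_eq_left_of_degree_lt (by rwa [degree_X_pow]), degree_X_pow]
  have hsplit := IsAlgClosed.splits q
  have hcard : q.roots.toList.length = n := by
    rw [Multiset.length_toList, ← hnat]
    exact hsplit.natDegree_eq_card_roots.symm
  have hprod : ∀ z : ℂ, q.eval z = ∏ i : Fin n, (z - q.roots.toList.get (i.cast hcard.symm)) := by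
    intro z
    have h1 : q = (q.roots.map (fun r ↦ X - C r)).prod := by
      conv_lhs => rw [hsplit.eq_prod_roots]
      simp [hmonic.leadingCoeff]
    have h2 : q.eval z = (q.roots.toList.map (fun r ↦ z - r)).prod := by
      conv_lhs => rw [h1]
      rw [eval_multiset_prod, Multiset.map_map, ← Multiset.prod_coe, ← Multiset.map_coe,
        Multiset.coe_toList]
      simp
    rw [h2, ← List.prod_ofFn]
    congr 1
    apply List.ext_get
    · simp [hcard]
    · intro i h3 h4
      simp
  refine ⟨fun i ↦ q.roots.toList.get (i.cast hcard.symm), fun τ ↦ ?_⟩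
  rcases eq_or_ne τ 0 with rfl | hτ
  · rw [Finset.sum_range_succ']
    simp [ha]
  · calc ∑ k ∈ Finset.range (n + 1), a k * τ ^ k = τ ^ n * q.eval τ⁻¹ := by
          rw [hq, eval_finsetSum, Finset.mul_sum]
          refine Finset.sum_congr rfl fun k hk ↦ ?_
          have := Finset.mem_range_succ_iff.1 hk
          have h5 : τ ^ n = τ ^ k * τ ^ (n - k) := by rw [← pow_add]; congr 1; lia
          simp only [eval_mul, eval_C, eval_pow, eval_X, inv_pow, h5]
          field_simp
      _ = _ := by
          have h6 : τ ^ n = ∏ _i : Fin n, τ := by simp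
          rw [hprod, h6, ← Finset.prod_mul_distrib]
          refine Finset.prod_congr rfl fun i _ ↦ ?_
          field_simp

theorem lintegral_inv_sqrt_lt_top :
    ∫⁻ t in Set.Icc (-1 : ℝ) 1, (‖t‖ₑ⁻¹) ^ (1 / 2 : ℝ) < ⊤ := by
  have h := (intervalIntegral.intervalIntegrable_cpow' (a := -1) (b := 1)
    (r := ((-(1 / 2) : ℝ) : ℂ)) (by norm_num))
  rw [intervalIntegrable_iff_integrableOn_Icc_of_le (by norm_num)] at h
  refine lt_of_eq_of_lt ?_ h.hasFiniteIntegral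
  have h0 : ∀ᵐ t : ℝ ∂(volume.restrict (Set.Icc (-1 : ℝ) 1)), t ≠ 0 :=
    ae_restrict_of_ae (by simp [ae_iff])
  refine lintegral_congr_ae ?_
  filter_upwards [h0] with t ht
  have h1 : ‖((t : ℂ) ^ (((-(1 / 2) : ℝ) : ℂ)))‖ₑ = ENNReal.ofReal (‖t‖ ^ (-(1 / 2) : ℝ)) := by
    rw [← ofReal_norm, Complex.norm_cpow_real]
    simp
  rw [h1, ← ENNReal.ofReal_rpow_of_pos (by simpa using ht), ofReal_norm, ENNReal.rpow_neg,
    ENNReal.inv_rpow]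

/-- The bound is uniform in `w` because `|1 - w τ| ≥ |1 - |w| τ|`, and the singularity of
`|t|^{-1/2}` is integrable. -/
theorem exists_lintegral_one_sub_le : ∃ C : ℝ≥0∞, C ≠ ⊤ ∧ 1 ≤ C ∧ ∀ w : ℂ,
    ∫⁻ τ in Set.Icc (0 : ℝ) 1, (‖1 - w * τ‖ₑ⁻¹) ^ (1 / 2 : ℝ) ≤ C := by
  set J := ∫⁻ t in Set.Icc (-1 : ℝ) 1, (‖t‖ₑ⁻¹) ^ (1 / 2 : ℝ) with hJ
  have hshift : ∀ a : ℝ, ∫⁻ τ in Set.Icc (0 : ℝ) 1, (‖τ - a‖ₑ⁻¹) ^ (1 / 2 : ℝ) ≤ 1 + J := by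
    intro a
    calc ∫⁻ τ in Set.Icc (0 : ℝ) 1, (‖τ - a‖ₑ⁻¹) ^ (1 / 2 : ℝ)
        ≤ ∫⁻ τ in Set.Icc (0 : ℝ) 1, (1 + (Set.Icc (-1 : ℝ) 1).indicator
            (fun t ↦ (‖t‖ₑ⁻¹) ^ (1 / 2 : ℝ)) (τ - a)) := by
          refine lintegral_mono fun τ ↦ ?_
          by_cases h : τ - a ∈ Set.Icc (-1 : ℝ) 1
          · simp [h]
          · have h1 : 1 ≤ ‖τ - a‖ₑ := by
              rw [← ofReal_norm, ENNReal.one_le_ofReal, Real.norm_eq_abs]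
              by_contra! h2
              exact h (abs_le.1 h2.le)
            simp only [h, not_false_eq_true, Set.indicator_of_notMem, add_zero]
            exact ENNReal.rpow_le_one (ENNReal.inv_le_one.2 h1) (by norm_num)
      _ ≤ 1 + ∫⁻ τ, (Set.Icc (-1 : ℝ) 1).indicator
            (fun t ↦ (‖t‖ₑ⁻¹) ^ (1 / 2 : ℝ)) (τ - a) := by
          rw [lintegral_add_left measurable_const]
          gcongr
          · simp
          · exact Measure.restrict_le_self
      _ = 1 + J := by
          rw [lintegral_sub_right_eq_self (fun τ ↦ (Set.Icc (-1 : ℝ) 1).indicator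
            (fun t ↦ (‖t‖ₑ⁻¹) ^ (1 / 2 : ℝ)) τ), lintegral_indicator measurableSet_Icc]
  have hJ' : J ≠ ⊤ := lintegral_inv_sqrt_lt_top.ne
  have h2 : ∀ x : ℝ≥0∞, ((x / 2)⁻¹) ^ (1 / 2 : ℝ) ≤ 2 * (x⁻¹) ^ (1 / 2 : ℝ) := by
    intro x
    rw [ENNReal.inv_div (by simp) (by simp), ENNReal.div_eq_inv_mul, mul_comm,
      ENNReal.mul_rpow_of_nonneg _ _ (by norm_num)]
    gcongr
    simpa using ENNReal.rpow_le_rpow_of_exponent_le (x := 2) (by norm_num)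
      (by norm_num : (1 / 2 : ℝ) ≤ 1)
  refine ⟨2 * (1 + J), by finiteness, ?_, fun w ↦ ?_⟩
  · calc (1 : ℝ≥0∞) ≤ 2 * 1 := by norm_num
      _ ≤ _ := by gcongr; simp
  have hrev : ∀ τ ∈ Set.Icc (0 : ℝ) 1, |1 - ‖w‖ * τ| ≤ ‖1 - w * τ‖ := by
    intro τ hτ
    have := abs_norm_sub_norm_le (1 : ℂ) (w * τ)
    simpa [abs_of_nonneg hτ.1] using this
  rcases le_or_gt ‖w‖ (1 / 2) with hw | hw
  · calc _ ≤ ∫⁻ τ in Set.Icc (0 : ℝ) 1, 2 := by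
          refine setLIntegral_mono measurable_const fun τ hτ ↦ ?_
          have h3 : (1 / 2 : ℝ) ≤ ‖1 - w * τ‖ := by
            refine le_trans ?_ (hrev τ hτ)
            rw [abs_of_nonneg] <;> nlinarith [hτ.1, hτ.2, norm_nonneg w]
          have h4 : (1 / 2 : ℝ≥0∞) ≤ ‖1 - w * τ‖ₑ := by
            rw [← ofReal_norm]
            refine le_trans (le_of_eq ?_) (ENNReal.ofReal_le_ofReal h3)
            rw [ENNReal.ofReal_div_of_pos (by norm_num)]; simp
          calc _ ≤ ((1 / 2 : ℝ≥0∞)⁻¹) ^ (1 / 2 : ℝ) := by gcongr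
            _ ≤ _ := by simpa using h2 1
      _ = 2 := by simp
      _ ≤ 2 * (1 + J) := le_mul_of_one_le_right (by simp) (by simp)
  · calc _ ≤ ∫⁻ τ in Set.Icc (0 : ℝ) 1, 2 * (‖τ - ‖w‖⁻¹‖ₑ⁻¹) ^ (1 / 2 : ℝ) := by
          refine setLIntegral_mono' measurableSet_Icc fun τ hτ ↦ ?_
          refine le_trans ?_ (h2 _)
          gcongr
          have h3 : ‖τ - ‖w‖⁻¹‖ / 2 ≤ ‖1 - w * τ‖ := by
            refine le_trans ?_ (hrev τ hτ)
            have : 1 - ‖w‖ * τ = -(‖w‖ * (τ - ‖w‖⁻¹)) := by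
              have : ‖w‖ ≠ 0 := by linarith
              field_simp
              ring
            rw [this, abs_neg, abs_mul, abs_norm, Real.norm_eq_abs]
            nlinarith [abs_nonneg (τ - ‖w‖⁻¹)]
          rw [← ofReal_norm, ← ofReal_norm]
          refine le_trans (le_of_eq ?_) (ENNReal.ofReal_le_ofReal h3)
          rw [ENNReal.ofReal_div_of_pos (by norm_num)]; simp
      _ = 2 * ∫⁻ τ in Set.Icc (0 : ℝ) 1, (‖τ - ‖w‖⁻¹‖ₑ⁻¹) ^ (1 / 2 : ℝ) := by
          rw [lintegral_const_mul]
          fun_prop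
      _ ≤ _ := by gcongr; exact hshift _

/-- For a polynomial of degree at most `n` with value `1` at `0`, the integral of the power
`-1 / (2n)` over `[0, 1]` is bounded independently of `n` and of the coefficients, by Hölder's
inequality for its `n` factors. -/
theorem lintegral_poly_inv_rpow_le {C : ℝ≥0∞}
    (hC : ∀ w : ℂ, ∫⁻ τ in Set.Icc (0 : ℝ) 1, (‖1 - w * τ‖ₑ⁻¹) ^ (1 / 2 : ℝ) ≤ C)
    {n : ℕ} (hn : n ≠ 0) (a : ℕ → ℂ) (ha : a 0 = 1) :
    ∫⁻ τ in Set.Icc (0 : ℝ) 1,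
      (‖∑ k ∈ Finset.range (n + 1), a k * (τ : ℂ) ^ k‖ₑ⁻¹) ^ (1 / (2 * n) : ℝ) ≤ C := by
  obtain ⟨w, hw⟩ := exists_prod_one_sub_eq n a ha
  have hn' : (n : ℝ) ≠ 0 := by exact_mod_cast hn
  have h1 : ∀ τ : ℝ, (‖∑ k ∈ Finset.range (n + 1), a k * (τ : ℂ) ^ k‖ₑ⁻¹) ^ (1 / (2 * n) : ℝ) =
      ∏ i, ((‖1 - w i * τ‖ₑ⁻¹) ^ (1 / 2 : ℝ)) ^ (1 / n : ℝ) := by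
    intro τ
    have h2 : ‖∏ i, (1 - w i * (τ : ℂ))‖ₑ = ∏ i, ‖1 - w i * (τ : ℂ)‖ₑ := by
      simp only [← ofReal_norm, norm_prod]
      exact ENNReal.ofReal_prod_of_nonneg fun i _ ↦ norm_nonneg _
    rw [hw, h2, ENNReal.prod_inv_distrib (fun _ _ i _ _ ↦ .inr enorm_ne_top),
      ← ENNReal.prod_rpow_of_nonneg (by positivity)]
    refine Finset.prod_congr rfl fun i _ ↦ ?_
    rw [← ENNReal.rpow_mul]
    congr 1
    field_simp
  simp_rw [h1]
  refine (ENNReal.lintegral_prod_norm_pow_le _ (fun i _ ↦ by fun_prop) ?_ ?_).trans ?_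
  · simp [hn']
  · intro i _; positivity
  · calc _ ≤ ∏ _i : Fin n, C ^ (1 / n : ℝ) := by
          gcongr
          exact hC _
      _ = C := by
          rw [Finset.prod_const, Finset.card_univ, Fintype.card_fin, ← ENNReal.rpow_natCast,
            ← ENNReal.rpow_mul]
          simp [hn']

/-- A Remez inequality for a family of polynomials `τ ↦ ∑ a k h τ ^ k` with a common value `F` at
`0`: the value `F` is controlled by the mean square over a set `E` of pairs `(h, τ)`, with a
constant that is exponential in the degree. -/
theorem remez_of_common_value {X : Type*} [MeasurableSpace X] {μ : Measure X} [SFinite μ]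
    {C : ℝ≥0∞}
    (hC : ∀ w : ℂ, ∫⁻ τ in Set.Icc (0 : ℝ) 1, (‖1 - w * τ‖ₑ⁻¹) ^ (1 / 2 : ℝ) ≤ C)
    {n : ℕ} (hn : n ≠ 0) {a : ℕ → X → ℂ} (hmeas : ∀ k, Measurable (a k)) {F : ℂ}
    (hF : ∀ h, a 0 h = F) {E : Set (X × ℝ)} {m κ : ℝ≥0∞} (hm : m ≠ ⊤) (hκ0 : κ ≠ 0) (hκ : κ ≠ ⊤)
    (hmE : m ≤ (μ.prod (volume.restrict (Set.Icc (0 : ℝ) 1))) E)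
    (hκm : κ * (C * μ Set.univ) ≤ m / 2) :
    m / 2 * κ ^ (4 * n) * ‖F‖ₑ ^ 2 ≤
      ∫⁻ z in E, ‖∑ k ∈ Finset.range (n + 1), a k z.1 * (z.2 : ℂ) ^ k‖ₑ ^ 2
        ∂(μ.prod (volume.restrict (Set.Icc (0 : ℝ) 1))) := by
  rcases eq_or_ne F 0 with rfl | hF0
  · simp
  set ν := μ.prod (volume.restrict (Set.Icc (0 : ℝ) 1)) with hν
  set P : X × ℝ → ℂ := fun z ↦ ∑ k ∈ Finset.range (n + 1), a k z.1 * (z.2 : ℂ) ^ k with hP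
  have hPm : Measurable P := by
    rw [hP]
    refine Finset.measurable_fun_sum _ fun k _ ↦ ?_
    have := hmeas k
    fun_prop
  have hF1 : ‖F‖ₑ ≠ 0 := by simpa using hF0
  have hn' : (n : ℝ) ≠ 0 := by exact_mod_cast hn
  -- The first term is at least `1` where `|P / F|² ≥ κ ^ (4 n)`, the second one elsewhere.
  have hpt : ∀ z, (1 : ℝ≥0∞) ≤ (κ ^ (4 * n))⁻¹ * (‖F‖ₑ ^ 2)⁻¹ * ‖P z‖ₑ ^ 2 +
      κ * (‖F⁻¹ * P z‖ₑ⁻¹) ^ (1 / (2 * n) : ℝ) := by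
    intro z
    have hy : (‖F‖ₑ ^ 2)⁻¹ * ‖P z‖ₑ ^ 2 = ‖F⁻¹ * P z‖ₑ ^ 2 := by
      rw [enorm_mul, mul_pow, enorm_inv hF0, ENNReal.inv_pow]
    rw [mul_assoc, hy]
    set y := ‖F⁻¹ * P z‖ₑ
    rcases le_total (κ ^ (2 * n)) y with h | h
    · refine le_add_right ?_
      calc (1 : ℝ≥0∞) = (κ ^ (4 * n))⁻¹ * κ ^ (4 * n) := by
            rw [ENNReal.inv_mul_cancel (by simp [hκ0]) (by finiteness)]
        _ = (κ ^ (4 * n))⁻¹ * (κ ^ (2 * n)) ^ 2 := by rw [← pow_mul]; congr 2; ring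
        _ ≤ _ := by gcongr
    · refine le_add_left ?_
      calc (1 : ℝ≥0∞) = κ * ((κ ^ (2 * n))⁻¹) ^ (1 / (2 * n) : ℝ) := by
            rw [ENNReal.inv_rpow, ← ENNReal.rpow_natCast, ← ENNReal.rpow_mul]
            have : ((2 * n : ℕ) : ℝ) * (1 / (2 * n)) = 1 := by
              push_cast
              field_simp
            rw [this, ENNReal.rpow_one, ENNReal.mul_inv_cancel hκ0 hκ]
        _ ≤ _ := by gcongr
  have hneg : ∫⁻ z, (‖F⁻¹ * P z‖ₑ⁻¹) ^ (1 / (2 * n) : ℝ) ∂ν ≤ C * μ Set.univ := by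
    rw [hν, lintegral_prod _ (by fun_prop)]
    calc _ ≤ ∫⁻ _h, C ∂μ := by
          refine lintegral_mono fun h ↦ ?_
          have := lintegral_poly_inv_rpow_le hC hn (fun k ↦ F⁻¹ * a k h)
            (by simp only [hF]; exact inv_mul_cancel₀ hF0)
          simpa only [hP, Finset.mul_sum, mul_assoc] using this
      _ = _ := by simp
  have hsum : m ≤ (κ ^ (4 * n))⁻¹ * (‖F‖ₑ ^ 2)⁻¹ * (∫⁻ z in E, ‖P z‖ₑ ^ 2 ∂ν) + m / 2 := by
    calc m ≤ ∫⁻ _z in E, 1 ∂ν := by simpa using hmE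
      _ ≤ ∫⁻ z in E, ((κ ^ (4 * n))⁻¹ * (‖F‖ₑ ^ 2)⁻¹ * ‖P z‖ₑ ^ 2 +
            κ * (‖F⁻¹ * P z‖ₑ⁻¹) ^ (1 / (2 * n) : ℝ)) ∂ν := lintegral_mono hpt
      _ = (κ ^ (4 * n))⁻¹ * (‖F‖ₑ ^ 2)⁻¹ * (∫⁻ z in E, ‖P z‖ₑ ^ 2 ∂ν) +
            κ * ∫⁻ z in E, (‖F⁻¹ * P z‖ₑ⁻¹) ^ (1 / (2 * n) : ℝ) ∂ν := by
          rw [lintegral_add_left (by fun_prop), lintegral_const_mul _ (by fun_prop),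
            lintegral_const_mul _ (by fun_prop)]
      _ ≤ _ := by
          gcongr
          refine le_trans ?_ hκm
          gcongr
          exact (setLIntegral_le_lintegral _ _).trans hneg
  have hhalf : m / 2 ≤ (κ ^ (4 * n))⁻¹ * (‖F‖ₑ ^ 2)⁻¹ * (∫⁻ z in E, ‖P z‖ₑ ^ 2 ∂ν) := by
    rw [← ENNReal.add_le_add_iff_right (a := m / 2) (by finiteness), ENNReal.add_halves]
    exact hsum
  calc m / 2 * κ ^ (4 * n) * ‖F‖ₑ ^ 2
      ≤ (κ ^ (4 * n))⁻¹ * (‖F‖ₑ ^ 2)⁻¹ * (∫⁻ z in E, ‖P z‖ₑ ^ 2 ∂ν) * κ ^ (4 * n) * ‖F‖ₑ ^ 2 := by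
        gcongr
    _ = ((κ ^ (4 * n))⁻¹ * κ ^ (4 * n)) * ((‖F‖ₑ ^ 2)⁻¹ * ‖F‖ₑ ^ 2) *
          ∫⁻ z in E, ‖P z‖ₑ ^ 2 ∂ν := by ring
    _ = _ := by
        rw [ENNReal.inv_mul_cancel (by simp [hκ0]) (by finiteness),
          ENNReal.inv_mul_cancel (by simp [hF0]) (by finiteness), one_mul, one_mul]

variable {d : ℕ}

/-! ### Taylor expansion of band-limited functions -/

theorem lintegral_enorm_sq_eq {α : Type*} [MeasurableSpace α] {μ : Measure α} (f : α → ℂ) :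
    ∫⁻ x, ‖f x‖ₑ ^ 2 ∂μ = eLpNorm f 2 μ ^ 2 := by
  have := eLpNorm_nnreal_pow_eq_lintegral (f := f) (μ := μ) (p := 2) (by norm_num)
  simpa using this.symm

theorem norm_exp_sub_sum_range_le (z : ℂ) (n : ℕ) {L : ℝ} (hL : 1 ≤ L) :
    ‖Complex.exp z - ∑ k ∈ Finset.range n, z ^ k / k.factorial‖ ≤
      (L ^ n)⁻¹ * Real.exp (L * ‖z‖) := by
  refine (Complex.norm_exp_sub_sum_le_exp_norm_sub_sum z n).trans ?_
  have hL0 : 0 < L := by linarith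
  have hs : ∀ r : ℝ, Summable (fun k : ℕ ↦ r ^ k / k.factorial) := Real.summable_pow_div_factorial
  have he : ∀ r : ℝ, Real.exp r = ∑' k : ℕ, r ^ k / k.factorial := fun r ↦ by
    rw [Real.exp_eq_exp_ℝ, NormedSpace.exp_eq_tsum_div]
  have h1 := (hs ‖z‖).sum_add_tsum_nat_add n
  have h2 := (hs (L * ‖z‖)).sum_add_tsum_nat_add n
  have h3 : 0 ≤ ∑ k ∈ Finset.range n, (L * ‖z‖) ^ k / k.factorial :=
    Finset.sum_nonneg fun k _ ↦ by positivity
  rw [he, he, ← h1, add_sub_cancel_left]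
  calc ∑' k : ℕ, ‖z‖ ^ (k + n) / (k + n).factorial
      ≤ ∑' k : ℕ, (L ^ n)⁻¹ * ((L * ‖z‖) ^ (k + n) / (k + n).factorial) := by
        refine Summable.tsum_le_tsum (fun k ↦ ?_) ((summable_nat_add_iff n).2 (hs _))
          (((summable_nat_add_iff n).2 (hs _)).mul_left _)
        rw [mul_pow, pow_add L, ← mul_div_assoc]
        gcongr
        have : (L ^ n)⁻¹ * (L ^ k * L ^ n * ‖z‖ ^ (k + n)) = L ^ k * ‖z‖ ^ (k + n) := by
          field_simp
        rw [this]
        exact le_mul_of_one_le_left (by positivity) (one_le_pow₀ hL)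
    _ = (L ^ n)⁻¹ * ∑' k : ℕ, (L * ‖z‖) ^ (k + n) / (k + n).factorial := tsum_mul_left
    _ ≤ _ := mul_le_mul_of_nonneg_left (by linarith) (by positivity)

/-- The inverse Fourier transform on `L²` is given by the Fourier integral for the integrable
functions in `L²`. -/
theorem L2.coeFn_fourierInv_ae_eq (g : L2 d) (hg : Integrable g) :
    ((𝓕⁻ g : L2 d) : Rd d → ℂ) =ᵐ[volume] 𝓕⁻ (g : Rd d → ℂ) := by
  have hcont : Continuous (𝓕⁻ (g : Rd d → ℂ)) := by
    have : 𝓕⁻ (g : Rd d → ℂ) = fun x ↦ 𝓕 (g : Rd d → ℂ) (-x) := by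
      ext x; exact Real.fourierInv_eq_fourier_neg _ _
    rw [this]
    exact (VectorFourier.fourierIntegral_continuous Real.continuous_fourierChar
      continuous_inner hg).comp continuous_neg
  refine ae_eq_of_integral_contDiff_smul_eq ((Lp.memLp _).locallyIntegrable (by norm_num))
    hcont.locallyIntegrable fun φ hφ hφc ↦ ?_
  have hg₁ : HasCompactSupport (Complex.ofRealCLM ∘ φ) := hφc.comp_left rfl
  have hg₂ : ContDiff ℝ ((⊤ : ℕ∞) : WithTop ℕ∞) (Complex.ofRealCLM ∘ φ) := by fun_prop
  set ψ : 𝓢(Rd d, ℂ) := hg₁.toSchwartzMap hg₂ with hψ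
  have hψφ : ∀ x, ψ x = φ x := fun x ↦ by simp [hψ]
  have h1 : ∀ F : Rd d → ℂ, ∫ x, φ x • F x = ∫ x, ψ x • F x := fun F ↦ by
    simp [hψφ]
  rw [h1, h1, ← Lp.toTemperedDistribution_apply, ← Lp.fourierInv_toTemperedDistribution_eq,
    TemperedDistribution.fourierInv_apply, Lp.toTemperedDistribution_apply]
  have := VectorFourier.integral_fourierIntegral_smul_eq_flip (μ := volume) (ν := volume)
    (L := -innerₗ (Rd d)) (f := ψ) (g := g) Real.continuous_fourierChar
    (continuous_inner (𝕜 := ℝ) (E := Rd d)).neg ψ.integrable hg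
  rw [show (-innerₗ (Rd d)).flip = -innerₗ (Rd d) by
    ext x y; simp [real_inner_comm]] at this
  rw [SchwartzMap.fourierInv_coe]
  exact this

/-- Plancherel's theorem for the Fourier integral. -/
theorem lintegral_enorm_sq_fourierInv {g : Rd d → ℂ} (h1 : Integrable g) (h2 : MemLp g 2) :
    ∫⁻ x, ‖𝓕⁻ g x‖ₑ ^ 2 = ∫⁻ ξ, ‖g ξ‖ₑ ^ 2 := by
  have hae := h2.coeFn_toLp
  have h3 : 𝓕⁻ g = 𝓕⁻ (h2.toLp g : Rd d → ℂ) := by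
    ext x
    rw [Real.fourierInv_eq_fourier_neg, Real.fourierInv_eq_fourier_neg]
    exact Real.fourier_congr_ae hae.symm _
  have h4 := L2.coeFn_fourierInv_ae_eq (h2.toLp g) (h1.congr hae.symm)
  rw [h3, lintegral_enorm_sq_eq, lintegral_enorm_sq_eq, ← eLpNorm_congr_ae h4,
    ← eLpNorm_congr_ae hae, ← Lp.enorm_def, ← Lp.enorm_def, ← ofReal_norm, ← ofReal_norm]
  congr 2
  exact (Lp.fourierTransformₗᵢ (Rd d) ℂ).symm.norm_map _

/-- The coefficients `(k!)⁻¹ (h · ∇)^k f (x)` of the expansion of `τ ↦ f (x + τ h)` in powers of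
`τ`, for the inverse Fourier transform `f` of `g`. -/
noncomputable def taylorCoeff (g : Rd d → ℂ) (k : ℕ) (x h : Rd d) : ℂ :=
  𝓕⁻ (fun ξ ↦ (((2 * π * inner ℝ ξ h : ℝ) : ℂ) * Complex.I) ^ k / k.factorial * g ξ) x

theorem taylorCoeff_zero (g : Rd d → ℂ) (x h : Rd d) : taylorCoeff g 0 x h = 𝓕⁻ g x := by
  simp [taylorCoeff]

theorem measurable_taylorCoeff {g : Rd d → ℂ} (hg : StronglyMeasurable g) (k : ℕ) :
    Measurable (fun p : Rd d × Rd d ↦ taylorCoeff g k p.1 p.2) := by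
  simp only [taylorCoeff, Real.fourierInv_eq']
  refine StronglyMeasurable.measurable
    (StronglyMeasurable.integral_prod_right' (f := fun q : (Rd d × Rd d) × Rd d ↦
      Complex.exp (((2 * π * inner ℝ q.2 q.1.1 : ℝ) : ℂ) * Complex.I) •
        ((((2 * π * inner ℝ q.2 q.1.2 : ℝ) : ℂ) * Complex.I) ^ k / k.factorial * g q.2)) ?_)
  have h1 : Continuous (fun q : (Rd d × Rd d) × Rd d ↦
      Complex.exp (((2 * π * inner ℝ q.2 q.1.1 : ℝ) : ℂ) * Complex.I)) := by fun_prop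
  have h2 : Continuous (fun q : (Rd d × Rd d) × Rd d ↦
      (((2 * π * inner ℝ q.2 q.1.2 : ℝ) : ℂ) * Complex.I) ^ k / k.factorial) := by fun_prop
  exact h1.stronglyMeasurable.smul (h2.stronglyMeasurable.mul (hg.comp_measurable measurable_snd))

/-- The remainder of the expansion `taylorCoeff` after the terms of degree at most `n`. -/
noncomputable def taylorRem (g : Rd d → ℂ) (n : ℕ) (x h : Rd d) (τ : ℝ) : ℂ :=
  𝓕⁻ g (x + τ • h) - ∑ k ∈ Finset.range (n + 1), taylorCoeff g k x h * (τ : ℂ) ^ k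

section BandLimited

variable {g : Rd d → ℂ} {N : ℝ}

theorem integrable_of_bandLimited (h2 : MemLp g 2) (hN : ∀ ξ, N < 2 * π * ‖ξ‖ → g ξ = 0) :
    Integrable g := by
  set K : Set (Rd d) := Metric.closedBall 0 (N / (2 * π))
  have hsupp : Function.support g ⊆ K := by
    intro ξ hξ
    rw [mem_closedBall_zero_iff, le_div_iff₀' (by positivity)]
    by_contra! h
    exact hξ (hN ξ h)
  rw [← integrableOn_iff_integrable_of_support_subset hsupp]
  have : IsFiniteMeasure (volume.restrict K) := ⟨by
    rw [Measure.restrict_apply_univ]; exact measure_closedBall_lt_top⟩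
  exact (h2.restrict K).integrable (by norm_num)

/-- A multiplier that is bounded on the band preserves integrability and square integrability. -/
theorem memLp_mul_of_bandLimited {φ : Rd d → ℂ} (hφ : Continuous φ)
    (hN : ∀ ξ, N < 2 * π * ‖ξ‖ → g ξ = 0) {M : ℝ} (hM : ∀ ξ, 2 * π * ‖ξ‖ ≤ N → ‖φ ξ‖ ≤ M)
    {p : ℝ≥0∞} (hp : MemLp g p) : MemLp (fun ξ ↦ φ ξ * g ξ) p := by
  refine MemLp.of_le_mul (c := M) hp (hφ.aestronglyMeasurable.mul hp.1) (.of_forall fun ξ ↦ ?_)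
  rcases le_or_gt (2 * π * ‖ξ‖) N with h | h
  · rw [norm_mul]
    gcongr
    exact hM ξ h
  · simp [hN ξ h]

theorem norm_phase_le {ξ h : Rd d} {ρ : ℝ} (hξ : 2 * π * ‖ξ‖ ≤ N) (hh : ‖h‖ ≤ ρ) :
    ‖((2 * π * inner ℝ ξ h : ℝ) : ℂ) * Complex.I‖ ≤ N * ρ := by
  rw [norm_mul, Complex.norm_I, mul_one, Complex.norm_real, Real.norm_eq_abs, abs_mul,
    abs_of_pos (by positivity)]
  calc 2 * π * |inner ℝ ξ h| ≤ 2 * π * (‖ξ‖ * ‖h‖) := by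
        gcongr
        exact abs_real_inner_le_norm _ _
    _ = (2 * π * ‖ξ‖) * ‖h‖ := by ring
    _ ≤ N * ρ := by
        gcongr
        exact le_trans (by positivity) hξ

theorem taylorRem_eq (h2 : MemLp g 2) (hN : ∀ ξ, N < 2 * π * ‖ξ‖ → g ξ = 0) (n : ℕ)
    (x h : Rd d) (τ : ℝ) :
    taylorRem g n x h τ = 𝓕⁻ (fun ξ ↦
      (Complex.exp (((2 * π * inner ℝ ξ h : ℝ) : ℂ) * Complex.I * τ) -
      ∑ k ∈ Finset.range (n + 1), (((2 * π * inner ℝ ξ h : ℝ) : ℂ) * Complex.I * τ) ^ k /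
        k.factorial) * g ξ) x := by
  have h1 := integrable_of_bandLimited h2 hN
  have hint : ∀ φ : Rd d → ℂ, Continuous φ → Integrable (fun ξ ↦ φ ξ * g ξ) := by
    intro φ hφ
    obtain ⟨M, hM⟩ := (isCompact_closedBall (0 : Rd d) (N / (2 * π))).exists_bound_of_continuousOn
      hφ.continuousOn
    refine memLp_one_iff_integrable.1 (memLp_mul_of_bandLimited hφ hN (M := M) (fun ξ hξ ↦ ?_)
      (memLp_one_iff_integrable.2 h1))
    exact hM ξ (by rwa [mem_closedBall_zero_iff, le_div_iff₀' (by positivity)])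
  simp only [taylorRem, taylorCoeff, Real.fourierInv_eq', smul_eq_mul]
  have e1 : ∀ k, (∫ ξ, Complex.exp (((2 * π * inner ℝ ξ x : ℝ) : ℂ) * Complex.I) *
      ((((2 * π * inner ℝ ξ h : ℝ) : ℂ) * Complex.I) ^ k / k.factorial * g ξ)) * (τ : ℂ) ^ k =
      ∫ ξ, (Complex.exp (((2 * π * inner ℝ ξ x : ℝ) : ℂ) * Complex.I) *
        ((((2 * π * inner ℝ ξ h : ℝ) : ℂ) * Complex.I * τ) ^ k / k.factorial)) * g ξ := by
    intro k
    rw [← integral_mul_const]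
    congr 1
    ext ξ
    rw [mul_pow _ (τ : ℂ)]
    ring
  have e2 : ∀ ξ : Rd d, Complex.exp (((2 * π * inner ℝ ξ (x + τ • h) : ℝ) : ℂ) * Complex.I) * g ξ =
      (Complex.exp (((2 * π * inner ℝ ξ x : ℝ) : ℂ) * Complex.I) *
        Complex.exp (((2 * π * inner ℝ ξ h : ℝ) : ℂ) * Complex.I * τ)) * g ξ := by
    intro ξ
    rw [← Complex.exp_add, inner_add_right, inner_smul_right]
    congr 2
    push_cast
    ring
  simp only [e1, e2]
  rw [← integral_finsetSum _ fun k _ ↦ hint _ (by fun_prop), ← integral_sub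
    (hint _ (by fun_prop)) (integrable_finsetSum _ fun k _ ↦ hint _ (by fun_prop))]
  congr 1
  ext ξ
  rw [← Finset.sum_mul, ← Finset.mul_sum]
  ring

/-- The mean square of the remainder in `x` is bounded by Plancherel's theorem; the gain `L ^ n` may
be taken with any base `L`, at the price of a factor exponential in the bandwidth. -/
theorem lintegral_enorm_sq_taylorRem_le (h2 : MemLp g 2)
    (hN : ∀ ξ, N < 2 * π * ‖ξ‖ → g ξ = 0) (n : ℕ) {L ρ : ℝ} (hL : 1 ≤ L) {h : Rd d}
    (hh : ‖h‖ ≤ ρ) {τ : ℝ} (hτ : τ ∈ Set.Icc (0 : ℝ) 1) :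
    ∫⁻ x, ‖taylorRem g n x h τ‖ₑ ^ 2 ≤
      ENNReal.ofReal ((L ^ (n + 1))⁻¹ * Real.exp (L * (N * ρ))) ^ 2 * ∫⁻ x, ‖𝓕⁻ g x‖ₑ ^ 2 := by
  have h1 := integrable_of_bandLimited h2 hN
  set φ : Rd d → ℂ := fun ξ ↦ Complex.exp (((2 * π * inner ℝ ξ h : ℝ) : ℂ) * Complex.I * τ)
      - ∑ k ∈ Finset.range (n + 1), (((2 * π * inner ℝ ξ h : ℝ) : ℂ) * Complex.I * τ) ^ k /
        k.factorial with hφ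
  have hφc : Continuous φ := by fun_prop
  have hφM : ∀ ξ, 2 * π * ‖ξ‖ ≤ N → ‖φ ξ‖ ≤ (L ^ (n + 1))⁻¹ * Real.exp (L * (N * ρ)) := by
    intro ξ hξ
    refine (norm_exp_sub_sum_range_le _ _ hL).trans ?_
    gcongr
    rw [norm_mul, Complex.norm_real, Real.norm_eq_abs, abs_of_nonneg hτ.1]
    exact (mul_le_of_le_one_right (norm_nonneg _) hτ.2).trans (norm_phase_le hξ hh)
  have hL1 := memLp_one_iff_integrable.1
    (memLp_mul_of_bandLimited hφc hN hφM (memLp_one_iff_integrable.2 h1))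
  have hL2 := memLp_mul_of_bandLimited hφc hN hφM h2
  have h3 : ∀ x, taylorRem g n x h τ = 𝓕⁻ (fun ξ ↦ φ ξ * g ξ) x := fun x ↦
    taylorRem_eq h2 hN n x h τ
  simp only [h3]
  rw [lintegral_enorm_sq_fourierInv hL1 hL2, lintegral_enorm_sq_fourierInv h1 h2,
    ← lintegral_const_mul' _ _ (by finiteness)]
  refine lintegral_mono fun ξ ↦ ?_
  rcases le_or_gt (2 * π * ‖ξ‖) N with h | h
  · rw [← mul_pow, enorm_mul]
    gcongr
    rw [← ofReal_norm]
    exact ENNReal.ofReal_le_ofReal (hφM ξ h)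
  · simp [hN ξ h]

end BandLimited

open scoped Pointwise in
/-- From every centre `x`, a thick set is seen along a set of segments `τ ↦ x + τ h` that is bounded
from below in measure. -/
theorem le_measure_segments {Ω : Set (Rd d)} (hΩ : MeasurableSet Ω) {R : ℝ} {x : Rd d} {γ : ℝ≥0∞}
    (hγ : γ ≤ volume (Ω ∩ {y | ∀ i, |y i - x i| ≤ R})) :
    γ / 2 ≤ ((volume.restrict {h : Rd d | ∀ i, |h i| ≤ 2 * R}).prod
      (volume.restrict (Set.Icc (0 : ℝ) 1))) {z | x + z.2 • z.1 ∈ Ω} := by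
  set B := {h : Rd d | ∀ i, |h i| ≤ 2 * R}
  have hmeas : MeasurableSet {z : Rd d × ℝ | x + z.2 • z.1 ∈ Ω} :=
    (by fun_prop : Measurable (fun z : Rd d × ℝ ↦ x + z.2 • z.1)) hΩ
  rw [Measure.prod_apply_symm hmeas]
  calc γ / 2 = ∫⁻ _τ in Set.Icc (1 / 2 : ℝ) 1, γ := by
        rw [setLIntegral_const, Real.volume_Icc, ENNReal.div_eq_inv_mul, mul_comm]
        congr 1
        rw [show (1 : ℝ) - 1 / 2 = 2⁻¹ by norm_num, ENNReal.ofReal_inv_of_pos (by norm_num)]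
        simp
    _ ≤ ∫⁻ τ in Set.Icc (1 / 2 : ℝ) 1, (volume.restrict B)
          ((fun h ↦ (h, τ)) ⁻¹' {z | x + z.2 • z.1 ∈ Ω}) := by
        refine setLIntegral_mono' measurableSet_Icc fun τ hτ ↦ hγ.trans ?_
        have hτ0 : 0 < τ := lt_of_lt_of_le (by norm_num) hτ.1
        have hms : MeasurableSet ((fun h : Rd d ↦ (h, τ)) ⁻¹' {z | x + z.2 • z.1 ∈ Ω}) :=
          (by fun_prop : Measurable (fun h : Rd d ↦ (h, τ))) hmeas
        rw [Measure.restrict_apply hms]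
        set S := (fun h : Rd d ↦ (h, τ)) ⁻¹' {z | x + z.2 • z.1 ∈ Ω} ∩ B with hS
        -- As `τ ≥ 1 / 2`, the points of `Ω` in the cube around `x` are of the form `x + τ h`.
        have hsub : Ω ∩ {y | ∀ i, |y i - x i| ≤ R} ⊆ (fun y ↦ x + y) '' (τ • S) := by
          rintro y ⟨hy, hyx⟩
          refine ⟨y - x, ⟨τ⁻¹ • (y - x), ⟨?_, ?_⟩, ?_⟩, by simp⟩
          · simpa [smul_smul, mul_inv_cancel₀ hτ0.ne'] using hy
          · intro i
            have h1 := hyx i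
            have h2 : (τ⁻¹ • (y - x)) i = τ⁻¹ * (y i - x i) := rfl
            rw [h2, abs_mul, abs_of_pos (inv_pos.2 hτ0), inv_mul_le_iff₀ hτ0]
            nlinarith [abs_nonneg (y i - x i), hτ.1]
          · simp [smul_smul, mul_inv_cancel₀ hτ0.ne']
        calc volume (Ω ∩ {y | ∀ i, |y i - x i| ≤ R}) ≤ volume ((fun y ↦ x + y) '' (τ • S)) :=
              measure_mono hsub
          _ = ENNReal.ofReal |τ ^ Module.finrank ℝ (Rd d)| * volume S := by
              rw [Set.image_add_left, measure_preimage_add, Measure.addHaar_smul]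
          _ ≤ volume S := by
              refine mul_le_of_le_one_left zero_le ?_
              rw [abs_of_nonneg (by positivity), ENNReal.ofReal_le_one]
              exact pow_le_one₀ hτ0.le hτ.2
    _ ≤ _ := lintegral_mono_set (Set.Icc_subset_Icc_left (by norm_num))

theorem measurable_fourierInv {g : Rd d → ℂ} (hg : StronglyMeasurable g) : Measurable (𝓕⁻ g) := by
  have := (measurable_taylorCoeff hg 0).comp (measurable_id.prodMk (measurable_const (a := 0)))
  simpa [taylorCoeff_zero, Function.comp_def] using this

theorem ennreal_add_sq_le (a b : ℝ≥0∞) : (a + b) ^ 2 ≤ 2 * (a ^ 2 + b ^ 2) := by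
  have := ENNReal.rpow_add_le_mul_rpow_add_rpow a b (p := 2) (by norm_num)
  norm_num at this
  exact_mod_cast this

theorem measurable_taylorRem {g : Rd d → ℂ} (hg : StronglyMeasurable g) (n : ℕ) :
    Measurable (fun p : Rd d × (Rd d × ℝ) ↦ taylorRem g n p.1 p.2.1 p.2.2) := by
  have h0 : Measurable (fun p : Rd d × (Rd d × ℝ) ↦ p.1 + p.2.2 • p.2.1) := by fun_prop
  have h1 : Measurable (fun p : Rd d × (Rd d × ℝ) ↦ (p.1, p.2.1)) := by fun_prop
  have h3 := (measurable_fourierInv hg).comp h0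
  have h4 := fun k ↦ (measurable_taylorCoeff hg k).comp h1
  have h5 : Measurable (fun p : Rd d × (Rd d × ℝ) ↦ (p.2.2 : ℂ)) := by fun_prop
  exact h3.sub (Finset.measurable_fun_sum _ fun k _ ↦ (h4 k).mul (h5.pow_const k))

/-- The Remez inequality for the polynomials of degree `n` that approximate a band-limited function
`f` along segments, averaged over all centres of these segments. -/
theorem lintegral_le_of_segments {C : ℝ≥0∞}
    (hC : ∀ w : ℂ, ∫⁻ τ in Set.Icc (0 : ℝ) 1, (‖1 - w * τ‖ₑ⁻¹) ^ (1 / 2 : ℝ) ≤ C)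
    {Ω B : Set (Rd d)} (hΩ : MeasurableSet Ω) (hB : MeasurableSet B) {ρ : ℝ}
    (hρ : ∀ h ∈ B, ‖h‖ ≤ ρ) {m κ : ℝ≥0∞} (hm : m ≠ ⊤) (hκ0 : κ ≠ 0) (hκ : κ ≠ ⊤)
    (hseg : ∀ x, m ≤ ((volume.restrict B).prod
      (volume.restrict (Set.Icc (0 : ℝ) 1))) {z | x + z.2 • z.1 ∈ Ω})
    (hκm : κ * (C * volume B) ≤ m / 2) {n : ℕ} (hn : n ≠ 0) {L : ℝ} (hL : 1 ≤ L)
    {g : Rd d → ℂ} {N : ℝ} (hg : StronglyMeasurable g) (h2 : MemLp g 2)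
    (hN : ∀ ξ, N < 2 * π * ‖ξ‖ → g ξ = 0) :
    m / 2 * κ ^ (4 * n) * ∫⁻ x, ‖𝓕⁻ g x‖ₑ ^ 2 ≤
      2 * volume B * ((∫⁻ x in Ω, ‖𝓕⁻ g x‖ₑ ^ 2) +
        ENNReal.ofReal ((L ^ (n + 1))⁻¹ * Real.exp (L * (N * ρ))) ^ 2 *
          ∫⁻ x, ‖𝓕⁻ g x‖ₑ ^ 2) := by
  set f := 𝓕⁻ g with hf
  set ν := (volume.restrict B).prod (volume.restrict (Set.Icc (0 : ℝ) 1)) with hν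
  set ε := ENNReal.ofReal ((L ^ (n + 1))⁻¹ * Real.exp (L * (N * ρ)))
  have hfm : Measurable f := measurable_fourierInv hg
  set u : Rd d → ℝ≥0∞ := Ω.indicator (fun y ↦ ‖f y‖ₑ ^ 2) with hu
  have hum : Measurable u := Measurable.indicator (by fun_prop) hΩ
  have hVm : Measurable (fun p : Rd d × (Rd d × ℝ) ↦
      2 * (u (p.1 + p.2.2 • p.2.1) + ‖taylorRem g n p.1 p.2.1 p.2.2‖ₑ ^ 2)) := by
    have h0 : Measurable (fun p : Rd d × (Rd d × ℝ) ↦ p.1 + p.2.2 • p.2.1) := by fun_prop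
    exact ((hum.comp h0).add ((measurable_taylorRem hg n).enorm.pow_const 2)).const_mul 2
  have hpt : ∀ x, m / 2 * κ ^ (4 * n) * ‖f x‖ₑ ^ 2 ≤
      ∫⁻ z, 2 * (u (x + z.2 • z.1) + ‖taylorRem g n x z.1 z.2‖ₑ ^ 2) ∂ν := by
    intro x
    have hE : MeasurableSet {z : Rd d × ℝ | x + z.2 • z.1 ∈ Ω} :=
      (by fun_prop : Measurable (fun z : Rd d × ℝ ↦ x + z.2 • z.1)) hΩ
    have hx : Measurable (fun h : Rd d ↦ (x, h)) := by fun_prop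
    have ham := fun k ↦ (measurable_taylorCoeff hg k).comp hx
    have hR := remez_of_common_value (μ := volume.restrict B) hC hn
      (a := fun k h ↦ taylorCoeff g k x h) ham
      (fun h ↦ taylorCoeff_zero g x h) hm hκ0 hκ (hseg x) (by simpa using hκm)
    refine hR.trans (le_trans ?_ (setLIntegral_le_lintegral
      {z : Rd d × ℝ | x + z.2 • z.1 ∈ Ω} _))
    refine setLIntegral_mono' hE fun z hz ↦ ?_
    have hz' : x + z.2 • z.1 ∈ Ω := hz
    have h3 : ∑ k ∈ Finset.range (n + 1), taylorCoeff g k x z.1 * (z.2 : ℂ) ^ k =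
        f (x + z.2 • z.1) - taylorRem g n x z.1 z.2 := by
      rw [taylorRem]; ring
    rw [h3, hu, Set.indicator_of_mem hz']
    calc _ ≤ (‖f (x + z.2 • z.1)‖ₑ + ‖taylorRem g n x z.1 z.2‖ₑ) ^ 2 := by
          gcongr
          exact enorm_sub_le
      _ ≤ _ := ennreal_add_sq_le _ _
  calc m / 2 * κ ^ (4 * n) * ∫⁻ x, ‖f x‖ₑ ^ 2
      = ∫⁻ x, m / 2 * κ ^ (4 * n) * ‖f x‖ₑ ^ 2 := by
        rw [lintegral_const_mul _ (by fun_prop)]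
    _ ≤ ∫⁻ x, ∫⁻ z, 2 * (u (x + z.2 • z.1) + ‖taylorRem g n x z.1 z.2‖ₑ ^ 2) ∂ν :=
        lintegral_mono hpt
    _ = ∫⁻ z, (∫⁻ x, 2 * (u (x + z.2 • z.1) + ‖taylorRem g n x z.1 z.2‖ₑ ^ 2)) ∂ν := by
        exact lintegral_lintegral_swap (f := fun (x : Rd d) (z : Rd d × ℝ) ↦
          2 * (u (x + z.2 • z.1) + ‖taylorRem g n x z.1 z.2‖ₑ ^ 2)) hVm.aemeasurable
    _ ≤ ∫⁻ z, 2 * ((∫⁻ x in Ω, ‖f x‖ₑ ^ 2) + ε ^ 2 * ∫⁻ x, ‖f x‖ₑ ^ 2) ∂ν := by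
        rw [hν, Measure.prod_restrict]
        refine setLIntegral_mono' (hB.prod measurableSet_Icc) fun z hz ↦ ?_
        have hum' : Measurable (fun x ↦ u (x + z.2 • z.1)) := hum.comp (measurable_add_const _)
        rw [lintegral_const_mul' _ _ (by simp), lintegral_add_left hum',
          lintegral_add_right_eq_self u, hu, lintegral_indicator hΩ]
        gcongr
        exact lintegral_enorm_sq_taylorRem_le h2 hN n hL (hρ _ hz.1) hz.2
    _ = _ := by
        rw [lintegral_const, hν, ← Set.univ_prod_univ, Measure.prod_prod]
        simp only [Measure.restrict_apply_univ, Real.volume_Icc]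
        simp only [sub_zero, ENNReal.ofReal_one, mul_one]
        ring

theorem measurableSet_cube (r : ℝ) : MeasurableSet {h : Rd d | ∀ i, |h i| ≤ r} := by
  rw [Set.ofPred_forall]
  exact MeasurableSet.iInter fun i ↦ measurableSet_le (by fun_prop) measurable_const

theorem norm_le_of_mem_cube {r : ℝ} {h : Rd d} (hh : ∀ i, |h i| ≤ r) : ‖h‖ ≤ √(d * r ^ 2) := by
  rw [EuclideanSpace.norm_eq]
  refine Real.sqrt_le_sqrt ?_
  calc ∑ i, ‖h i‖ ^ 2 ≤ ∑ _i : Fin d, r ^ 2 := by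
        gcongr with i
        exact hh i
    _ = _ := by simp

/-! ### The Logvinenko–Sereda theorem -/

/-- The **Logvinenko–Sereda theorem**, with a constant that is exponential in the bandwidth. -/
theorem logvinenko_sereda {Ω : Set (Rd d)} (hΩ : IsThick Ω) :
    ∃ A₁ A₂ : ℝ, 0 < A₁ ∧ 0 < A₂ ∧ ∀ N : ℝ, 0 ≤ N → ∀ g : Rd d → ℂ, StronglyMeasurable g →
      MemLp g 2 → (∀ ξ, N < 2 * π * ‖ξ‖ → g ξ = 0) →
      ∫⁻ x, ‖𝓕⁻ g x‖ₑ ^ 2 ≤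
        ENNReal.ofReal (A₁ * Real.exp (A₂ * N)) * ∫⁻ x in Ω, ‖𝓕⁻ g x‖ₑ ^ 2 := by
  obtain ⟨hΩm, R, hR, hγ⟩ := hΩ
  obtain ⟨C, hCtop, hC1, hC⟩ := exists_lintegral_one_sub_le
  set γ := ⨅ a : Rd d, volume (Ω ∩ {x | ∀ i, |x i - a i| ≤ R})
  set B : Set (Rd d) := {h | ∀ i, |h i| ≤ 2 * R} with hB
  set ρ : ℝ := √(d * (2 * R) ^ 2) with hρ
  have hρB : ∀ h ∈ B, ‖h‖ ≤ ρ := fun h hh ↦ norm_le_of_mem_cube hh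
  have hBm : MeasurableSet B := measurableSet_cube _
  have hBtop : volume B ≠ ⊤ := by
    refine ((measure_mono (t := Metric.closedBall 0 ρ) fun h hh ↦ ?_).trans_lt
      measure_closedBall_lt_top).ne
    simpa using hρB h hh
  have hseg : ∀ x, γ / 2 ≤ ((volume.restrict B).prod
      (volume.restrict (Set.Icc (0 : ℝ) 1))) {z | x + z.2 • z.1 ∈ Ω} := fun x ↦
    le_measure_segments hΩm (iInf_le _ x)
  have hγB : γ / 2 ≤ volume B := by
    refine (hseg 0).trans ((measure_mono (Set.subset_univ _)).trans ?_)
    rw [← Set.univ_prod_univ, Measure.prod_prod]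
    simp
  have hγ2 : γ / 2 ≠ 0 := by simpa using hγ.ne'
  -- The constants, as real numbers: `m` is the measure of the segments, `b` that of the cube.
  obtain ⟨m, hm0, hm⟩ : ∃ m : ℝ, 0 < m ∧ γ / 2 = ENNReal.ofReal m :=
    ⟨(γ / 2).toReal, ENNReal.toReal_pos hγ2 (ne_top_of_le_ne_top hBtop hγB),
      (ENNReal.ofReal_toReal (ne_top_of_le_ne_top hBtop hγB)).symm⟩
  have hB0 : volume B ≠ 0 := fun h ↦ hγ2 (by simpa [h] using hγB)
  obtain ⟨b, hb0, hb⟩ : ∃ b : ℝ, 0 < b ∧ volume B = ENNReal.ofReal b :=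
    ⟨(volume B).toReal, ENNReal.toReal_pos hB0 hBtop, (ENNReal.ofReal_toReal hBtop).symm⟩
  have hC0 : C ≠ 0 := (zero_lt_one.trans_le hC1).ne'
  obtain ⟨c, hc1, hc⟩ : ∃ c : ℝ, 1 ≤ c ∧ C = ENNReal.ofReal c := by
    refine ⟨C.toReal, ?_, (ENNReal.ofReal_toReal hCtop).symm⟩
    rwa [← ENNReal.ofReal_le_iff_le_toReal hCtop, ENNReal.ofReal_one]
  have hmb : m ≤ b := by
    rw [hm, hb] at hγB
    exact (ENNReal.ofReal_le_ofReal_iff hb0.le).1 hγB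
  set κ : ℝ := m / (2 * c * b) with hκ
  have hc0 : 0 < c := by linarith
  have hκ0 : 0 < κ := by positivity
  have hκ1 : κ ≤ 1 := by
    rw [hκ, div_le_one (by positivity)]
    nlinarith
  -- The base of the remainder estimate: a gain `exp (-2n)` remains after the loss `κ ^ (4n)`.
  set L : ℝ := Real.exp 1 * (κ ^ 2)⁻¹ with hL
  have hκ2 : 1 ≤ (κ ^ 2)⁻¹ := (one_le_inv₀ (by positivity)).2 (pow_le_one₀ hκ0.le hκ1)
  have hL1 : 1 ≤ L := one_le_mul_of_one_le_of_one_le (Real.one_le_exp (by norm_num)) hκ2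
  set D : ℝ := |Real.log (8 * b / m)| with hD
  have hDm : 8 * b ≤ m * Real.exp D := by
    have := Real.exp_le_exp.2 (le_abs_self (Real.log (8 * b / m)))
    rw [Real.exp_log (by positivity), div_le_iff₀ hm0] at this
    linarith
  have hρ0 : 0 ≤ ρ := Real.sqrt_nonneg _
  set K : ℝ := -(4 * Real.log κ) with hK
  have hK0 : 0 ≤ K := by have := Real.log_nonpos hκ0.le hκ1; linarith
  have hpow : ∀ n : ℕ, κ ^ (4 * n) = Real.exp (-(K * n)) := by
    intro n
    rw [← Real.exp_log (pow_pos hκ0 (4 * n)), Real.log_pow, hK]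
    congr 1
    push_cast
    ring
  refine ⟨8 * b / m * Real.exp (K * (D + 2)), K * (L * ρ) + 1, by positivity, by positivity,
    fun N hN0 g hg h2 hN ↦ ?_⟩
  set S := ∫⁻ x, ‖𝓕⁻ g x‖ₑ ^ 2 with hS
  set SΩ := ∫⁻ x in Ω, ‖𝓕⁻ g x‖ₑ ^ 2 with hSΩ
  have hStop : S ≠ ⊤ := by
    rw [hS, lintegral_enorm_sq_fourierInv (integrable_of_bandLimited h2 hN) h2,
      lintegral_enorm_sq_eq]
    exact ENNReal.pow_ne_top h2.2.ne
  set T : ℝ := L * (N * ρ) with hT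
  have hT0 : 0 ≤ T := by positivity
  obtain ⟨n, hn0, hn1, hn2⟩ : ∃ n : ℕ, n ≠ 0 ∧ T + D ≤ n ∧ (n : ℝ) ≤ T + D + 2 := by
    refine ⟨⌈T + D⌉₊ + 1, by simp, ?_, ?_⟩
    · push_cast; linarith [Nat.le_ceil (T + D)]
    · push_cast; linarith [Nat.ceil_lt_add_one (by positivity : 0 ≤ T + D)]
  have key := lintegral_le_of_segments (L := L) (κ := ENNReal.ofReal κ) hC hΩm hBm hρB
    (by rw [hm]; exact ENNReal.ofReal_ne_top) (by simpa using hκ0) ENNReal.ofReal_ne_top hseg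
    (by
      rw [hm, hb, hc, ← ENNReal.ofReal_mul hc0.le, ← ENNReal.ofReal_mul hκ0.le,
        ← ENNReal.ofReal_ofNat, ← ENNReal.ofReal_div_of_pos (by norm_num)]
      refine ENNReal.ofReal_le_ofReal (le_of_eq ?_)
      rw [hκ]
      field_simp) hn0 hL1 hg h2 hN
  rw [← hS, ← hSΩ] at key
  -- The remainder is absorbed by the left-hand side.
  have hrem : 2 * b * ((L ^ (n + 1))⁻¹ * Real.exp T) ^ 2 ≤ m / 4 * κ ^ (4 * n) := by
    have h3 : ((L ^ n)⁻¹) ^ 2 = Real.exp (-(2 * n)) * κ ^ (4 * n) := by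
      have h4 : Real.exp (-(2 * n)) = ((Real.exp 1 ^ n)⁻¹) ^ 2 := by
        rw [← Real.exp_nat_mul, ← Real.exp_neg, ← Real.exp_nat_mul]
        congr 1
        push_cast
        ring
      have h5 : (((κ ^ 2)⁻¹) ^ n)⁻¹ = κ ^ (2 * n) := by rw [inv_pow, inv_inv, pow_mul]
      rw [hL, h4, mul_pow, mul_inv, mul_pow, h5, ← pow_mul κ]
      congr 2
      ring
    have h4 : (L ^ (n + 1))⁻¹ ≤ (L ^ n)⁻¹ := by
      gcongr
      · lia
    calc 2 * b * ((L ^ (n + 1))⁻¹ * Real.exp T) ^ 2 ≤ 2 * b * ((L ^ n)⁻¹ * Real.exp T) ^ 2 := by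
          gcongr
      _ = (8 * b) / 4 * (Real.exp (-(2 * n)) * Real.exp T ^ 2) * κ ^ (4 * n) := by
          rw [mul_pow, h3]; ring
      _ ≤ (m * Real.exp D) / 4 * (Real.exp (-(2 * n)) * Real.exp T ^ 2) * κ ^ (4 * n) := by
          gcongr
      _ = m / 4 * Real.exp (D - 2 * n + 2 * T) * κ ^ (4 * n) := by
          rw [Real.exp_add, Real.exp_sub, Real.exp_neg, two_mul T, Real.exp_add]; ring
      _ ≤ m / 4 * 1 * κ ^ (4 * n) := by
          gcongr
          rw [Real.exp_le_one_iff]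
          linarith [abs_nonneg (Real.log (8 * b / m))]
      _ = _ := by ring
  by_cases hSΩtop : SΩ = ⊤
  · rw [hSΩtop, ENNReal.mul_top (by simp; positivity)]
    exact le_top
  obtain ⟨S', hS'0, hS'⟩ : ∃ s : ℝ, 0 ≤ s ∧ S = ENNReal.ofReal s :=
    ⟨S.toReal, ENNReal.toReal_nonneg, (ENNReal.ofReal_toReal hStop).symm⟩
  obtain ⟨SΩ', hSΩ'0, hSΩ'⟩ : ∃ s : ℝ, 0 ≤ s ∧ SΩ = ENNReal.ofReal s :=
    ⟨SΩ.toReal, ENNReal.toReal_nonneg, (ENNReal.ofReal_toReal hSΩtop).symm⟩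
  have key' : m / 2 * κ ^ (4 * n) * S' ≤
      2 * b * (SΩ' + ((L ^ (n + 1))⁻¹ * Real.exp T) ^ 2 * S') := by
    rw [← ENNReal.ofReal_le_ofReal_iff (by positivity)]
    convert key using 1
    · rw [hm, hS', ENNReal.ofReal_mul (by positivity), ENNReal.ofReal_mul (by positivity),
        ENNReal.ofReal_pow hκ0.le, ENNReal.ofReal_div_of_pos (by norm_num), ENNReal.ofReal_ofNat]
    · rw [hb, hS', hSΩ', ENNReal.ofReal_mul (by positivity), ENNReal.ofReal_mul (by positivity),
        ENNReal.ofReal_add hSΩ'0 (by positivity), ENNReal.ofReal_mul (by positivity),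
        ENNReal.ofReal_pow (by positivity), ENNReal.ofReal_ofNat]
  rw [hS', hSΩ', ← ENNReal.ofReal_mul (by positivity)]
  refine ENNReal.ofReal_le_ofReal ?_
  have h5 : m / 4 * κ ^ (4 * n) * S' ≤ 2 * b * SΩ' := by
    have := mul_le_mul_of_nonneg_right hrem hS'0
    linarith
  rw [hpow] at h5
  have h6 : S' ≤ 8 * b / m * Real.exp (K * n) * SΩ' := by
    have h7 : Real.exp (K * n) * Real.exp (-(K * n)) = 1 := by rw [← Real.exp_add]; simp
    calc S' = 4 / m * Real.exp (K * n) * (m / 4 * Real.exp (-(K * n)) * S') := by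
          rw [show 4 / m * Real.exp (K * n) * (m / 4 * Real.exp (-(K * n)) * S') =
            (m / m) * (Real.exp (K * n) * Real.exp (-(K * n))) * S' by ring, h7,
            div_self hm0.ne']
          ring
      _ ≤ 4 / m * Real.exp (K * n) * (2 * b * SΩ') := by gcongr
      _ = _ := by ring
  refine h6.trans ?_
  rw [mul_assoc (8 * b / m) _ (Real.exp _), ← Real.exp_add]
  gcongr
  calc K * n ≤ K * (T + D + 2) := by gcongr
    _ = K * (D + 2) + K * (L * ρ) * N := by rw [hT]; ring
    _ ≤ _ := by linarith

/-! ### The operators on the Fourier side -/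

theorem fracSymbol_pos (σ : ℝ) (ξ : Rd d) : 0 < fracSymbol d σ ξ := by
  unfold fracSymbol; positivity

theorem one_le_fracSymbol {σ : ℝ} (hσ : 0 ≤ σ) (ξ : Rd d) : 1 ≤ fracSymbol d σ ξ :=
  Real.one_le_rpow (by simp) (by positivity)

theorem norm_le_fracSymbol {σ : ℝ} (hσ : 1 ≤ σ) (ξ : Rd d) : 2 * π * ‖ξ‖ ≤ fracSymbol d σ ξ := by
  have h1 : ‖(2 * π) • ξ‖ = 2 * π * ‖ξ‖ := by
    rw [norm_smul, Real.norm_of_nonneg (by positivity)]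
  calc 2 * π * ‖ξ‖ = √(‖(2 * π) • ξ‖ ^ 2) := by rw [Real.sqrt_sq (norm_nonneg _), h1]
    _ ≤ √(1 + ‖(2 * π) • ξ‖ ^ 2) := Real.sqrt_le_sqrt (by linarith)
    _ = (1 + ‖(2 * π) • ξ‖ ^ 2) ^ (1 / 2 : ℝ) := Real.sqrt_eq_rpow _
    _ ≤ _ := Real.rpow_le_rpow_of_exponent_le (by simp) (by linarith)

theorem fracSymbol_neg_mul (σ : ℝ) (ξ : Rd d) : fracSymbol d σ ξ * fracSymbol d (-σ) ξ = 1 := by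
  rw [fracSymbol, fracSymbol, ← Real.rpow_add (by positivity)]
  simp [neg_div]

open scoped BoundedContinuousFunction in
/-- On the Fourier side, `(1 - Δ)^{σ/2}` is the multiplication by its symbol. For `σ ≥ 0` the symbol
of the inverse operator is bounded, so that the identity reduces to one in `L²`. -/
theorem fourier_ae_eq_fracSymbol_mul {σ : ℝ} (hσ : 0 ≤ σ) {u v : L2 d}
    (h : L2.toDist v = fracOp d σ (L2.toDist u)) :
    ((𝓕 v : L2 d) : Rd d → ℂ) =ᵐ[volume] fun ξ ↦ (fracSymbol d σ ξ : ℂ) * (𝓕 u : L2 d) ξ := by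
  have hg₁ := hasTemperateGrowth_fracSymbol_ofReal d (-σ)
  set g' : Rd d →ᵇ ℂ := BoundedContinuousFunction.ofNormedAddCommGroup
    (fun ξ ↦ (fracSymbol d (-σ) ξ : ℂ)) hg₁.1.continuous 1 (fun ξ ↦ by
      rw [Complex.norm_real, Real.norm_of_nonneg (fracSymbol_pos _ _).le]
      exact Real.rpow_le_one_of_one_le_of_nonpos (by simp) (by linarith)) with hg'
  have h1 : L2.toDist u = fracOp d (-σ) (L2.toDist v) := by
    rw [h, fracOp_fracOp, add_neg_cancel, fracOp_zero]; rfl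
  have hmem : MemLp (fun ξ ↦ (fracSymbol d (-σ) ξ : ℂ)) ⊤ (volume : Measure (Rd d)) :=
    g'.memLp_top
  have h2 : (𝓕 u : L2 d) = (hmem.toLp _ • (𝓕 v : L2 d) : L2 d) := by
    apply L2.toDist_injective
    rw [L2.toDist_apply, L2.toDist_apply, Lp.toTemperedDistribution_smul_eq hg₁,
      ← Lp.fourier_toTemperedDistribution_eq, ← Lp.fourier_toTemperedDistribution_eq,
      ← L2.toDist_apply, h1, fracOp, fourierMultiplierCLM_apply, fourier_fourierInv_eq]
    rfl
  have h3 := Lp.coeFn_lpSMul (r := 2) (hmem.toLp _) (𝓕 v : L2 d)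
  rw [← h2] at h3
  filter_upwards [h3, hmem.coeFn_toLp] with ξ h4 h5
  rw [h4, Pi.smul_apply', h5, smul_eq_mul, ← mul_assoc, ← Complex.ofReal_mul, fracSymbol_neg_mul]
  simp

theorem ofReal_norm_sq_eq_lintegral (f : L2 d) :
    ENNReal.ofReal (‖f‖ ^ 2) = ∫⁻ x, ‖f x‖ₑ ^ 2 := by
  rw [lintegral_enorm_sq_eq, ← Lp.enorm_def, ← ofReal_norm, ENNReal.ofReal_pow (norm_nonneg _)]

theorem ofReal_setIntegral_norm_sq (f : L2 d) (Ω : Set (Rd d)) :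
    ENNReal.ofReal (∫ x in Ω, ‖f x‖ ^ 2) = ∫⁻ x in Ω, ‖f x‖ₑ ^ 2 := by
  have h := (Lp.memLp f).integrable_norm_pow (by norm_num)
  rw [ofReal_integral_eq_lintegral_ofReal h.integrableOn (.of_forall fun x ↦ by positivity)]
  simp_rw [ENNReal.ofReal_pow (norm_nonneg _), ofReal_norm]

theorem norm_fourierInv_eq (f : L2 d) : ‖(𝓕⁻ f : L2 d)‖ = ‖f‖ :=
  (Lp.fourierTransformₗᵢ (Rd d) ℂ).symm.norm_map f

theorem norm_add_sq_le_two_mul {E : Type*} [SeminormedAddCommGroup E] (x y : E) :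
    ‖x + y‖ ^ 2 ≤ 2 * (‖x‖ ^ 2 + ‖y‖ ^ 2) :=
  (pow_le_pow_left₀ (norm_nonneg _) (norm_add_le x y) 2).trans add_sq_le

/-- The Logvinenko–Sereda theorem for functions that are not band-limited: `H` bounds the mass of
the frequencies above `N`. -/
theorem norm_sq_le_of_fourier_high {Ω : Set (Rd d)} (hΩ : IsThick Ω) :
    ∃ A₁ A₂ : ℝ, 0 < A₁ ∧ 0 < A₂ ∧ ∀ N : ℝ, 0 ≤ N → ∀ (u : L2 d) (H : ℝ),
      (∫⁻ ξ in {ξ | N < 2 * π * ‖ξ‖}, ‖(𝓕 u : L2 d) ξ‖ₑ ^ 2 ≤ ENNReal.ofReal H) → 0 ≤ H →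
      ‖u‖ ^ 2 ≤ A₁ * Real.exp (A₂ * N) * ((∫ x in Ω, ‖u x‖ ^ 2) + H) := by
  obtain ⟨A₁, A₂, hA₁, hA₂, hLS⟩ := logvinenko_sereda hΩ
  refine ⟨4 * A₁ + 2, A₂, by positivity, hA₂, fun N hN u H hH hH0 ↦ ?_⟩
  set G : Set (Rd d) := {ξ | N < 2 * π * ‖ξ‖} with hG
  have hGm : MeasurableSet G := measurableSet_lt measurable_const (by fun_prop)
  set g : Rd d → ℂ := Gᶜ.indicator (𝓕 u : L2 d) with hg
  have hgm : StronglyMeasurable g := (Lp.stronglyMeasurable _).indicator hGm.compl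
  have hg2 : MemLp g 2 := (Lp.memLp _).indicator hGm.compl
  have hgN : ∀ ξ, N < 2 * π * ‖ξ‖ → g ξ = 0 := fun ξ hξ ↦
    Set.indicator_of_notMem (by simpa [hG] using hξ) _
  set l : L2 d := 𝓕⁻ (hg2.toLp g) with hl
  have hlae : (l : Rd d → ℂ) =ᵐ[volume] 𝓕⁻ g := by
    refine (L2.coeFn_fourierInv_ae_eq _
      ((integrable_of_bandLimited hg2 hgN).congr hg2.coeFn_toLp.symm)).trans (.of_forall fun x ↦ ?_)
    rw [Real.fourierInv_eq_fourier_neg, Real.fourierInv_eq_fourier_neg]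
    exact Real.fourier_congr_ae hg2.coeFn_toLp _
  have hhigh : ‖u - l‖ ^ 2 ≤ H := by
    rw [← ENNReal.ofReal_le_ofReal_iff hH0]
    refine le_trans (le_of_eq ?_) hH
    have h1 : ‖u - l‖ = ‖(𝓕 u : L2 d) - hg2.toLp g‖ := by
      rw [← norm_fourierInv_eq ((𝓕 u : L2 d) - hg2.toLp g), sub_eq_add_neg,
        sub_eq_add_neg (𝓕 u : L2 d), fourierInv_add, fourierInv_neg, fourierInv_fourier_eq]
    rw [h1, ofReal_norm_sq_eq_lintegral, ← lintegral_indicator hGm]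
    refine lintegral_congr_ae ?_
    filter_upwards [Lp.coeFn_sub (𝓕 u : L2 d) (hg2.toLp g), hg2.coeFn_toLp] with ξ h2 h3
    rw [h2, Pi.sub_apply, h3]
    by_cases h : ξ ∈ G <;> simp [hg, h]
  have hlow : ‖l‖ ^ 2 ≤ A₁ * Real.exp (A₂ * N) * (2 * ((∫ x in Ω, ‖u x‖ ^ 2) + H)) := by
    have hI : 0 ≤ ∫ x in Ω, ‖u x‖ ^ 2 := integral_nonneg fun x ↦ by positivity
    rw [← ENNReal.ofReal_le_ofReal_iff (by positivity),
      ENNReal.ofReal_mul (p := A₁ * Real.exp (A₂ * N)) (by positivity),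
      ENNReal.ofReal_mul (p := 2) (by norm_num), ENNReal.ofReal_add hI hH0,
      ofReal_setIntegral_norm_sq, ofReal_norm_sq_eq_lintegral, ENNReal.ofReal_ofNat]
    calc ∫⁻ x, ‖l x‖ₑ ^ 2 = ∫⁻ x, ‖𝓕⁻ g x‖ₑ ^ 2 := by
          refine lintegral_congr_ae ?_
          filter_upwards [hlae] with x hx
          rw [hx]
      _ ≤ ENNReal.ofReal (A₁ * Real.exp (A₂ * N)) * ∫⁻ x in Ω, ‖𝓕⁻ g x‖ₑ ^ 2 :=
          hLS N hN g hgm hg2 hgN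
      _ ≤ _ := by
          gcongr
          calc ∫⁻ x in Ω, ‖𝓕⁻ g x‖ₑ ^ 2
              ≤ ∫⁻ x in Ω, 2 * (‖u x‖ₑ ^ 2 + ‖(u - l) x‖ₑ ^ 2) := by
                refine lintegral_mono_ae (ae_restrict_of_ae ?_)
                filter_upwards [hlae, Lp.coeFn_sub u l] with x h1 h2
                rw [← h1, h2, Pi.sub_apply]
                calc ‖l x‖ₑ ^ 2 = ‖u x - (u x - l x)‖ₑ ^ 2 := by rw [sub_sub_cancel]
                  _ ≤ (‖u x‖ₑ + ‖u x - l x‖ₑ) ^ 2 := by gcongr; exact enorm_sub_le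
                  _ ≤ _ := ennreal_add_sq_le _ _
            _ = 2 * ((∫⁻ x in Ω, ‖u x‖ₑ ^ 2) + ∫⁻ x in Ω, ‖(u - l) x‖ₑ ^ 2) := by
                rw [lintegral_const_mul' _ _ (by simp), lintegral_add_left']
                exact ((Lp.aestronglyMeasurable u).enorm.pow_const 2).restrict
            _ ≤ _ := by
                gcongr
                refine (setLIntegral_le_lintegral _ _).trans ?_
                rw [← ofReal_norm_sq_eq_lintegral]
                exact ENNReal.ofReal_le_ofReal hhigh
  have hI : 0 ≤ ∫ x in Ω, ‖u x‖ ^ 2 := integral_nonneg fun x ↦ by positivity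
  have hE : 1 ≤ Real.exp (A₂ * N) := Real.one_le_exp (by positivity)
  have h1 := norm_add_sq_le_two_mul l (u - l)
  rw [add_sub_cancel] at h1
  have h2 : H ≤ Real.exp (A₂ * N) * ((∫ x in Ω, ‖u x‖ ^ 2) + H) := by
    calc H ≤ (∫ x in Ω, ‖u x‖ ^ 2) + H := by linarith
      _ ≤ _ := le_mul_of_one_le_left (by positivity) hE
  linarith

/-- At a frequency `m ≥ |λ| + 1`, the resolvent equation bounds the velocity `u` by the data, since
`(m² - λ²) u = m p - i λ q` and `m² - λ² ≥ m`. -/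
theorem norm_velocity_le {m lam : ℝ} (hm : |lam| + 1 ≤ m) {u a p q : ℂ}
    (hp : p = m * u - Complex.I * lam * a) (hq : q = -(m * a) - Complex.I * lam * u) :
    ‖u‖ ≤ ‖p‖ + ‖q‖ := by
  have hl := abs_nonneg lam
  have h1 : ((m ^ 2 - lam ^ 2 : ℝ) : ℂ) * u = m * p - Complex.I * lam * q := by
    rw [hp, hq]
    push_cast
    ring_nf
    rw [Complex.I_sq]
    ring
  have h2 : (m ^ 2 - lam ^ 2) * ‖u‖ ≤ m * ‖p‖ + |lam| * ‖q‖ := by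
    have h3 : 0 ≤ m ^ 2 - lam ^ 2 := by rw [← sq_abs lam]; nlinarith
    calc (m ^ 2 - lam ^ 2) * ‖u‖ = ‖((m ^ 2 - lam ^ 2 : ℝ) : ℂ) * u‖ := by
          rw [norm_mul, Complex.norm_real, Real.norm_of_nonneg h3]
      _ ≤ ‖(m : ℂ) * p‖ + ‖Complex.I * lam * q‖ := by rw [h1]; exact norm_sub_le _ _
      _ = _ := by
          simp [abs_of_nonneg (by linarith : 0 ≤ m)]
  have h4 : m ≤ m ^ 2 - lam ^ 2 := by rw [← sq_abs lam]; nlinarith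
  have hm0 : 0 < m := by linarith
  have h5 : m * ‖u‖ ≤ m * (‖p‖ + ‖q‖) := by
    calc m * ‖u‖ ≤ (m ^ 2 - lam ^ 2) * ‖u‖ := by gcongr
      _ ≤ m * ‖p‖ + |lam| * ‖q‖ := h2
      _ ≤ m * ‖p‖ + m * ‖q‖ := by gcongr; linarith
      _ = _ := by ring
  exact le_of_mul_le_mul_left h5 hm0

/-! ### The resolvent estimate -/

/-- The observability estimate for the resolvent, in terms of the functions
`a = (1 - Δ)^{s/4} u₁` and `u = u₂` of `L²`. -/
theorem resolvent_observability {s : ℝ} (hs : 2 ≤ s) {Ω : Set (Rd d)} (hΩ : IsThick Ω) :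
    ∃ C c : ℝ, 0 < C ∧ 0 < c ∧ ∀ (lam : ℝ) (u a v₁ v₂ p q : L2 d),
      L2.toDist v₂ = fracOp d (s / 2) (L2.toDist u) →
      L2.toDist v₁ = fracOp d (s / 2) (L2.toDist a) →
      p = v₂ - (Complex.I * (lam : ℂ)) • a → q = -v₁ - (Complex.I * (lam : ℂ)) • u →
      c * Real.exp (-C * |lam|) * (‖a‖ ^ 2 + ‖u‖ ^ 2) ≤
        ‖p‖ ^ 2 + ‖q‖ ^ 2 + ∫ x in Ω, ‖u x‖ ^ 2 := by
  obtain ⟨A₁, A₂, hA₁, hA₂, hobs⟩ := norm_sq_le_of_fourier_high hΩ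
  refine ⟨A₂ + 2, (6 * (A₁ * Real.exp A₂ + 1))⁻¹, by positivity, by positivity,
    fun lam u a v₁ v₂ p q hv₂ hv₁ hp hq ↦ ?_⟩
  set I := ∫ x in Ω, ‖u x‖ ^ 2 with hI
  have hI0 : 0 ≤ I := integral_nonneg fun x ↦ by positivity
  have hF₂ := fourier_ae_eq_fracSymbol_mul (by linarith) hv₂
  have hF₁ := fourier_ae_eq_fracSymbol_mul (by linarith) hv₁
  have hFp : ∀ᵐ ξ, (𝓕 p : L2 d) ξ = (fracSymbol d (s / 2) ξ : ℂ) * (𝓕 u : L2 d) ξ -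
      Complex.I * lam * (𝓕 a : L2 d) ξ := by
    have h1 : (𝓕 p : L2 d) = 𝓕 v₂ - (Complex.I * (lam : ℂ)) • 𝓕 a := by
      rw [hp, sub_eq_add_neg, FourierAdd.fourier_add, FourierTransform.fourier_neg,
        fourier_smul, ← sub_eq_add_neg]
    filter_upwards [hF₂, Lp.coeFn_sub (𝓕 v₂ : L2 d) ((Complex.I * (lam : ℂ)) • 𝓕 a),
      Lp.coeFn_smul (Complex.I * (lam : ℂ)) (𝓕 a : L2 d)] with ξ h2 h3 h4
    rw [h1, h3, Pi.sub_apply, h4, h2, Pi.smul_apply, smul_eq_mul]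
  have hFq : ∀ᵐ ξ, (𝓕 q : L2 d) ξ = -((fracSymbol d (s / 2) ξ : ℂ) * (𝓕 a : L2 d) ξ) -
      Complex.I * lam * (𝓕 u : L2 d) ξ := by
    have h1 : (𝓕 q : L2 d) = -𝓕 v₁ - (Complex.I * (lam : ℂ)) • 𝓕 u := by
      rw [hq, sub_eq_add_neg, FourierAdd.fourier_add, FourierTransform.fourier_neg,
        FourierTransform.fourier_neg, fourier_smul,
        ← sub_eq_add_neg]
    filter_upwards [hF₁, Lp.coeFn_sub (-𝓕 v₁ : L2 d) ((Complex.I * (lam : ℂ)) • 𝓕 u),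
      Lp.coeFn_smul (Complex.I * (lam : ℂ)) (𝓕 u : L2 d), Lp.coeFn_neg (𝓕 v₁ : L2 d)]
      with ξ h2 h3 h4 h5
    rw [h1, h3, Pi.sub_apply, h4, h5, Pi.neg_apply, h2, Pi.smul_apply, smul_eq_mul]
  have hl := abs_nonneg lam
  set w : ℝ := ‖p‖ ^ 2 + ‖q‖ ^ 2 with hw
  have hw0 : 0 ≤ w := by positivity
  -- The velocity: the frequencies above `|λ| + 1` are controlled by the resolvent equation.
  have hu2 : ‖u‖ ^ 2 ≤ A₁ * Real.exp (A₂ * (|lam| + 1)) * (I + 2 * w) := by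
    refine hobs _ (by positivity) u _ ?_ (by positivity)
    rw [hw, ENNReal.ofReal_mul (by norm_num), ENNReal.ofReal_add (by positivity) (by positivity),
      ← Lp.norm_fourier_eq p, ← Lp.norm_fourier_eq q, ofReal_norm_sq_eq_lintegral,
      ofReal_norm_sq_eq_lintegral, ENNReal.ofReal_ofNat,
      ← lintegral_add_left' ((Lp.aestronglyMeasurable _).enorm.pow_const 2),
      ← lintegral_const_mul' _ _ (by simp)]
    refine le_trans (lintegral_mono_ae ?_) (setLIntegral_le_lintegral _ _)
    rw [ae_restrict_iff' (measurableSet_lt measurable_const (by fun_prop))]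
    filter_upwards [hFp, hFq] with ξ h1 h2 hξ
    have hm : |lam| + 1 ≤ fracSymbol d (s / 2) ξ :=
      (le_of_lt hξ).trans (norm_le_fracSymbol (by linarith) ξ)
    refine le_trans ?_ (ennreal_add_sq_le _ _)
    gcongr
    simp only [← ofReal_norm]
    rw [← ENNReal.ofReal_add (norm_nonneg _) (norm_nonneg _)]
    exact ENNReal.ofReal_le_ofReal (norm_velocity_le hm h1 h2)
  -- The position: the second component of the resolvent equation.
  have ha2 : ‖a‖ ^ 2 ≤ 2 * (w + lam ^ 2 * ‖u‖ ^ 2) := by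
    have h1 : ‖a‖ ≤ ‖v₁‖ := by
      rw [← Lp.norm_fourier_eq a, ← Lp.norm_fourier_eq v₁]
      refine Lp.norm_le_norm_of_ae_le ?_
      filter_upwards [hF₁] with ξ h2
      rw [h2, norm_mul, Complex.norm_real, Real.norm_of_nonneg (fracSymbol_pos _ _).le]
      exact le_mul_of_one_le_left (norm_nonneg _) (one_le_fracSymbol (by linarith) ξ)
    have h2 : v₁ = -q + -((Complex.I * (lam : ℂ)) • u) := by rw [hq]; abel
    calc ‖a‖ ^ 2 ≤ ‖v₁‖ ^ 2 := by gcongr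
      _ ≤ 2 * (‖-q‖ ^ 2 + ‖-((Complex.I * (lam : ℂ)) • u)‖ ^ 2) := by
          rw [h2]; exact norm_add_sq_le_two_mul _ _
      _ = 2 * (‖q‖ ^ 2 + lam ^ 2 * ‖u‖ ^ 2) := by
          rw [norm_neg, norm_neg, norm_smul, norm_mul, Complex.norm_I, one_mul, Complex.norm_real,
            mul_pow, Real.norm_eq_abs, sq_abs]
      _ ≤ _ := by
          rw [hw]
          have := sq_nonneg ‖p‖
          linarith
  set Y := w + I with hY
  have hE : 1 ≤ Real.exp (A₂ * |lam|) := Real.one_le_exp (by positivity)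
  have hexp : 1 + 2 * lam ^ 2 ≤ Real.exp (2 * |lam|) := by
    have := Real.quadratic_le_exp_of_nonneg (x := 2 * |lam|) (by positivity)
    rw [← sq_abs lam]
    nlinarith
  have hu3 : ‖u‖ ^ 2 ≤ 2 * (A₁ * Real.exp A₂) * Real.exp (A₂ * |lam|) * Y := by
    refine hu2.trans ?_
    rw [mul_add A₂, mul_one, Real.exp_add]
    calc _ ≤ A₁ * (Real.exp (A₂ * |lam|) * Real.exp A₂) * (2 * Y) := by
          gcongr
          rw [hY]; linarith
      _ = _ := by ring
  have hY0 : 0 ≤ Y := by positivity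
  set Z := Real.exp (A₂ * |lam|) * Y with hZ
  have hYZ : Y ≤ Z := le_mul_of_one_le_left hY0 hE
  have htot : (‖a‖ ^ 2 + ‖u‖ ^ 2) ≤
      6 * (A₁ * Real.exp A₂ + 1) * (Real.exp (2 * |lam|) * Z) := by
    have h1 : (1 + 2 * lam ^ 2) * ‖u‖ ^ 2 ≤
        Real.exp (2 * |lam|) * (2 * (A₁ * Real.exp A₂) * Z) := by
      refine mul_le_mul hexp (hu3.trans (le_of_eq ?_)) (by positivity) (by positivity)
      rw [hZ]; ring
    have h2 : Z ≤ Real.exp (2 * |lam|) * Z :=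
      le_mul_of_one_le_left (by positivity) (Real.one_le_exp (by positivity))
    have h3 : 0 ≤ A₁ * Real.exp A₂ * (Real.exp (2 * |lam|) * Z) := by positivity
    have h4 : 0 ≤ Z := hY0.trans hYZ
    nlinarith
  calc (6 * (A₁ * Real.exp A₂ + 1))⁻¹ * Real.exp (-(A₂ + 2) * |lam|) * (‖a‖ ^ 2 + ‖u‖ ^ 2)
      ≤ (6 * (A₁ * Real.exp A₂ + 1))⁻¹ * Real.exp (-(A₂ + 2) * |lam|) *
          (6 * (A₁ * Real.exp A₂ + 1) * (Real.exp (2 * |lam|) * Z)) := by gcongr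
    _ = ((6 * (A₁ * Real.exp A₂ + 1))⁻¹ * (6 * (A₁ * Real.exp A₂ + 1))) *
          (Real.exp (-(A₂ + 2) * |lam|) * Real.exp (2 * |lam|) * Real.exp (A₂ * |lam|)) * Y := by
        rw [hZ]; ring
    _ = Y := by
        rw [inv_mul_cancel₀ (by positivity), ← Real.exp_add, ← Real.exp_add]
        ring_nf
        simp

end FractionalWave

open FractionalWave in
theorem mainTheorem3 (d : ℕ) (hd : 1 ≤ d) (s : ℝ) (hs : 2 ≤ s)
    (Ω : Set (FractionalWave.Rd d)) (hΩ : FractionalWave.IsThick Ω) :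
    ∃ C c : ℝ, 0 < C ∧ 0 < c ∧
      ∀ (U : (FractionalWave.waveGenerator d s).domain) (lam : ℝ),
        c * Real.exp (-C * |lam|) * ‖(U : FractionalWave.Energy d s)‖ ^ 2 ≤
          ‖FractionalWave.waveGenerator d s U
              - (Complex.I * (lam : ℂ)) • (U : FractionalWave.Energy d s)‖ ^ 2
            + ∫ x in Ω, ‖(U : FractionalWave.Energy d s).snd x‖ ^ 2 := by
  obtain ⟨C, c, hC, hc, h⟩ := resolvent_observability (d := d) hs hΩ
  refine ⟨C, c, hC, hc, fun U lam ↦ ?_⟩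
  -- The distribution `u₁` belongs to `H^s`, so `(1 - Δ)^{s/2} u₁ = (1 - Δ)^{s/4} (1 - Δ)^{s/4} u₁`.
  have hv₂ := Sobolev.toDist_frac (waveDomain.snd (s := s) U)
  have hv₁ := Sobolev.toDist_frac (waveDomain.fst (s := s) U)
  have ha := Sobolev.toDist_frac (U : Energy d s).fst
  rw [waveDomain.toDist_snd (s := s) U] at hv₂
  rw [waveDomain.toDist_fst (s := s) U] at hv₁
  have hv₁' := fracOp_fracOp d (s / 2) (s / 2) (Sobolev.toDist (U : Energy d s).fst)
  rw [add_halves, ← ha] at hv₁'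
  rw [Energy.norm_sq, Energy.norm_sq, Sobolev.norm_def, Sobolev.norm_def]
  refine h lam _ _ _ _ _ _ hv₂ (hv₁.trans hv₁'.symm) ?_ rfl
  rw [WithLp.sub_fst, WithLp.smul_fst, map_sub, map_smul, waveGenerator_apply]
  rfl
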